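/- Proposition (Unimodular Gauss–Bonnet theorem). Let $V$ be a $3$-dimensional real vector space with a (full-rank) lattice $N\subset V$. Let $\Delta$ be a complete unimodular fan in $V$, that is, a finite collection of convex cones with apex at the origin, closed under taking faces, such that any two cones of $\Delta$ intersect in a common face, the union of all cones is $V$, and every cone is generated by a part of a $\mathbb{Z}$-basis of $N$ (so that $\Delta$ is in particular simplicial). Let $K$ be the underlying simplicial complex of $\Delta$: its vertices are the primitive generators in $N$ of the rays of $\Delta$, and a set of vertices is a simplex if it generates a cone of $\Delta$. A wall is a simplex $J=\{j_1,j_2\}$ of $K$ with two vertices. Its unimodular curvature is $\operatorname{curv}(J)=2-a_1-a_2$, where $J\cup\{i\}$ and $J\cup\{i'\}$ are two different maximal simplices of $K$ containing $J$ and the integers $a_1,a_2$ are determined by $i'=a_1j_1+a_2j_2-i$. Then $\operatorname{curv}(J)$ is well defined for every wall $J$ (such $i,i',a_1,a_2$ exist and the value does not depend on the choice), and $$\sum_{J\in K,\ |J|=2}\operatorname{curv}(J)=24 .$$ -/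

import Mathlib

/-- A fan in a real vector space `V`: a finite collection of convex cones with apex at the origin,
closed under passing to faces, in which any two cones intersect in a common face (the intersection
then also lies in the collection). -/
structure ConeFan (V : Type*) [AddCommGroup V] [Module ℝ V] where
  cones : Finset (PointedCone ℝ V)
  face_mem : ∀ σ ∈ cones, ∀ τ : PointedCone ℝ V, τ.IsFaceOf σ → τ ∈ cones
  inf_isFaceOf : ∀ σ ∈ cones, ∀ τ ∈ cones, (σ ⊓ τ).IsFaceOf σ ∧ (σ ⊓ τ).IsFaceOf τ

/-- A cone is unimodular with respect to the lattice `N` if it is generated by a part of a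
`ℤ`-basis of `N`. -/
def IsUnimodularCone {V : Type*} [AddCommGroup V] [Module ℝ V] (N : Submodule ℤ V)
    (σ : PointedCone ℝ V) : Prop :=
  ∃ (b : Module.Basis (Fin (Module.finrank ℤ N)) ℤ N) (s : Set (Fin (Module.finrank ℤ N))),
    σ = PointedCone.hull ℝ ((fun k => (b k : V)) '' s)

/-- A primitive vector of the lattice `N`: a nonzero lattice vector which is not a proper integer
multiple of a lattice vector. -/
def IsPrimitiveVector {V : Type*} [AddCommGroup V] (N : Submodule ℤ V) (v : V) : Prop :=
  v ∈ N ∧ v ≠ 0 ∧ ∀ (k : ℤ), ∀ w ∈ N, v = k • w → IsUnit k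

/-- A primitive lattice vector is determined by the ray that it spans. -/
theorem IsPrimitiveVector.eq_of_hull_eq {V : Type*} [NormedAddCommGroup V] [NormedSpace ℝ V]
    {N : Submodule ℤ V} [DiscreteTopology N] {v w : V}
    (hv : IsPrimitiveVector N v) (hw : IsPrimitiveVector N w)
    (h : PointedCone.hull ℝ {v} = PointedCone.hull ℝ {w}) : v = w := by
  obtain ⟨hvN, hv0, hvp⟩ := hv
  obtain ⟨hwN, hw0, hwp⟩ := hw
  have hmem : v ∈ PointedCone.hull ℝ {w} := h ▸ Submodule.subset_span rfl
  obtain ⟨⟨r, hr⟩, hrv⟩ := Submodule.mem_span_singleton.1 hmem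
  replace hrv : r • w = v := hrv
  have hG : ∃ g : ℝ, ∀ t : ℝ, t • w ∈ N ↔ ∃ m : ℤ, t = m * g := by
    let G : AddSubgroup ℝ := N.toAddSubgroup.comap (LinearMap.toSpanSingleton ℝ V w).toAddMonoidHom
    have hGd : DiscreteTopology G := by
      have hinj : Function.Injective (fun t : ℝ => t • w) := smul_left_injective ℝ hw0
      have hc : Continuous (fun t : G => (⟨(t : ℝ) • w, t.2⟩ : N)) := by fun_prop
      exact DiscreteTopology.of_continuous_injective hc
        (fun a b hab => Subtype.ext (hinj (congrArg Subtype.val hab)))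
    obtain ⟨g, hg⟩ := (AddSubgroup.discrete_iff_addCyclic.2 hGd).exists_zsmul_surjective
    refine ⟨g, fun t => ?_⟩
    constructor
    · intro ht
      obtain ⟨m, hm⟩ := hg ⟨t, ht⟩
      refine ⟨m, ?_⟩
      have := congrArg Subtype.val hm
      simpa using this.symm
    · rintro ⟨m, rfl⟩
      have : (m • g : G).1 ∈ G := (m • g : G).2
      simpa [G] using this
  obtain ⟨g, hg⟩ := hG
  obtain ⟨k, hk⟩ := (hg 1).1 (by simpa using hwN)
  have hgN : g • w ∈ N := (hg g).2 ⟨1, by simp⟩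
  have hku := hwp k (g • w) hgN (by rw [← Int.cast_smul_eq_zsmul ℝ, smul_smul, ← hk, one_smul])
  obtain ⟨m, hm⟩ := (hg r).1 (by rw [hrv]; exact hvN)
  have hmu := hvp m (g • w) hgN (by rw [← Int.cast_smul_eq_zsmul ℝ, smul_smul, ← hm, hrv])
  have hr1 : r = 1 := by
    rcases Int.isUnit_iff.1 hku with rfl | rfl <;> rcases Int.isUnit_iff.1 hmu with rfl | rfl <;>
      push_cast at hk hm <;> linarith
  rw [← hrv, hr1, one_smul]

namespace ConeFan

section Basic

variable {V : Type*} [AddCommGroup V] [Module ℝ V]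

/-- A fan is complete if its cones cover the whole space. -/
def IsComplete (Δ : ConeFan V) : Prop :=
  ∀ x : V, ∃ σ ∈ Δ.cones, x ∈ σ

/-- A fan is unimodular if all its cones are (in particular it is then simplicial). -/
def IsUnimodular (Δ : ConeFan V) (N : Submodule ℤ V) : Prop :=
  ∀ σ ∈ Δ.cones, IsUnimodularCone N σ

end Basic

variable {V : Type*} [NormedAddCommGroup V] [NormedSpace ℝ V]

theorem finite_primitive (Δ : ConeFan V) (N : Submodule ℤ V) [DiscreteTopology N] :
    {v : V | IsPrimitiveVector N v ∧ PointedCone.hull ℝ {v} ∈ Δ.cones}.Finite :=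
  Set.Finite.of_finite_image (f := fun v => PointedCone.hull ℝ {v})
    (Δ.cones.finite_toSet.subset (by rintro _ ⟨v, hv, rfl⟩; exact hv.2))
    (fun _ hv _ hw h => hv.1.eq_of_hull_eq hw.1 h)

/-- The primitive generators of the rays of the fan; they serve as the vertices of the underlying
simplicial complex `K`. -/
noncomputable def rayGenerators (Δ : ConeFan V) (N : Submodule ℤ V) [DiscreteTopology N] :
    Finset V :=
  (Δ.finite_primitive N).toFinset

open Classical in
/-- The simplices with `k` vertices of the underlying simplicial complex `K` of the fan: sets of
`k` ray generators that span a cone of the fan. -/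
noncomputable def simplices (Δ : ConeFan V) (N : Submodule ℤ V) [DiscreteTopology N] (k : ℕ) :
    Finset (Finset V) :=
  {I ∈ (Δ.rayGenerators N).powersetCard k | PointedCone.hull ℝ (I : Set V) ∈ Δ.cones}

/-- The walls of a fan in an `n`-dimensional space: the simplices of `K` with `n - 1` vertices. -/
noncomputable def walls (Δ : ConeFan V) (N : Submodule ℤ V) [DiscreteTopology N] :
    Finset (Finset V) :=
  Δ.simplices N (Module.finrank ℝ V - 1)

open Classical in
/-- `c = 2 - ∑ aⱼ`, where `J ∪ {i}` and `J ∪ {i'}` are two different maximal simplices containing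
the wall `J`, and `i' = ∑ aⱼ j - i` with integers `aⱼ`, `j ∈ J`. -/
def HasCurvature (Δ : ConeFan V) (N : Submodule ℤ V) [DiscreteTopology N] (J : Finset V)
    (c : ℤ) : Prop :=
  ∃ (i i' : V) (a : V → ℤ), i ≠ i' ∧
    insert i J ∈ Δ.simplices N (Module.finrank ℝ V) ∧
    insert i' J ∈ Δ.simplices N (Module.finrank ℝ V) ∧
    i' = (∑ j ∈ J, a j • j) - i ∧
    c = 2 - ∑ j ∈ J, a j

/-- The unimodular curvature of a wall. -/
noncomputable def curv (Δ : ConeFan V) (N : Submodule ℤ V) [DiscreteTopology N] (J : Finset V) :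
    ℤ :=
  Classical.epsilon (Δ.HasCurvature N J)

end ConeFan

/-! This is localization on a smooth complete toric threefold: χ(𝒪) = 1 gives c₁c₂ = 24, done here
with explicit series.

A wall `J` has exactly one maximal simplex on each side of its hyperplane, by completeness and the
intersection axiom. Each is a lattice basis, so the primitive functional `f` vanishing on `J` is ±1
at the two extra vertices, and their sum is an integral combination of `J`. This makes the curvature
well defined.

For the sum, fix a generic `x` with coordinates x_v in the basis `I`, and evaluate S = ∑_I (∑_v
x_v)(∑_v 1/x_v) twice.

Over flags (I, v), S is the sum of (∑_u x_u)/x_v. The two flags over a wall `J` have denominators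
±f(x), and their numerators differ by (2 - a₁ - a₂) f(x), so together they contribute curv(J)
(`sum_curv_eq`).

On the other hand ∑_I ∏_{v ∈ I} 1/(1 - e^{-t x_v}) = 1 for all t > 0 (`sum_prod_todd_eq_one`). Since
1/(1 - e^{-s}) = 1/s + 1/2 + s/12 + O(s³), the constant term in t of the left side is S/24, hence S
= 24.

To obtain the identity, expand each factor as the geometric series that converges for the sign of
x_v. The coefficient of e^{-t m(x)}, for `m` in the dual lattice, is then `signedCount`. It is
independent of the generic `x`, because the jumps of neighbouring cones cancel at walls. For m ≠ 0
it vanishes where m is negative, hence everywhere generic; for m = 0 it counts the maximal cones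
containing `x`, which is 1. -/

open PointedCone Filter Topology

/-! ### Faces and coordinates of finitely generated cones -/

namespace PointedCone

variable {V : Type*} [AddCommGroup V] [Module ℝ V]

theorem mem_hull_finset {I : Finset V} {x : V} :
    x ∈ hull ℝ (I : Set V) ↔ ∃ c : V → ℝ, (∀ v, 0 ≤ c v) ∧ ∑ v ∈ I, c v • v = x := by
  rw [hull, Submodule.mem_span_finset']
  constructor
  · rintro ⟨f, rfl⟩
    classical
    refine ⟨fun v => if h : v ∈ I then (f ⟨v, h⟩ : ℝ) else 0, fun v => ?_, ?_⟩
    · dsimp only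
      split_ifs
      · exact (f _).2
      · exact le_rfl
    · rw [← Finset.sum_coe_sort]
      refine Finset.sum_congr rfl fun v _ => ?_
      simp only [v.2, dif_pos]
      rfl
  · rintro ⟨c, hc, rfl⟩
    refine ⟨fun v => ⟨c v, hc v⟩, ?_⟩
    exact Finset.sum_coe_sort I fun v => c v • v

/-- Coefficients are unique by independence, so outside `A` those of `a • x + y` vanish; being sums
of nonnegative terms with `a > 0`, they force those of `x` to vanish. -/
theorem isFaceOf_hull_of_subset {I A : Finset V} (hI : LinearIndepOn ℝ id (I : Set V))
    (hA : A ⊆ I) : (hull ℝ (A : Set V)).IsFaceOf (hull ℝ (I : Set V)) := by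
  classical
  refine ⟨Submodule.span_mono (by exact_mod_cast hA), ?_⟩
  intro x y a hx hy ha hxy
  obtain ⟨c, hc, rfl⟩ := mem_hull_finset.1 hx
  obtain ⟨d, hd, rfl⟩ := mem_hull_finset.1 hy
  obtain ⟨e, he, hsum⟩ := mem_hull_finset.1 hxy
  have h0 : ∑ v ∈ I, (a * c v + d v - if v ∈ A then e v else 0) • id v = 0 := by
    simp only [sub_smul, add_smul, mul_smul, Finset.sum_sub_distrib, Finset.sum_add_distrib, id,
      ite_smul, zero_smul, Finset.sum_ite_mem, Finset.inter_eq_right.2 hA, hsum, Finset.smul_sum]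
    simp
  have h1 := linearIndepOn_finset_iff.1 hI _ h0
  have h2 : ∀ v ∈ I, v ∉ A → c v • v = 0 := by
    intro v hv hvA
    have h3 := h1 v hv
    simp only [hvA, if_false, sub_zero] at h3
    have : c v = 0 := by
      have := hc v
      have := hd v
      nlinarith [mul_nonneg ha.le (hc v)]
    rw [this, zero_smul]
  rw [← Finset.sum_subset hA h2]
  exact mem_hull_finset.2 ⟨c, hc, rfl⟩

theorem IsFaceOf.mem_of_sum_mem_of_pos {I : Finset V} {F : PointedCone ℝ V}
    (hF : F.IsFaceOf (hull ℝ (I : Set V))) {c : V → ℝ} (hc : ∀ v ∈ I, 0 ≤ c v)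
    (hs : ∑ v ∈ I, c v • v ∈ F) {v : V} (hv : v ∈ I) (hcv : 0 < c v) : v ∈ F := by
  classical
  rw [← Finset.add_sum_erase I _ hv] at hs
  refine hF.mem_of_smul_add_mem (Submodule.subset_span hv) ?_ hcv hs
  exact Submodule.sum_mem _ fun w hw => (hull ℝ (I : Set V)).smul_mem
    (hc w (Finset.mem_of_mem_erase hw)) (Submodule.subset_span (Finset.mem_of_mem_erase hw))

theorem mem_hull_image_basis {ι : Type*} [Fintype ι] (b : Module.Basis ι ℝ V) (s : Set ι) {x : V} :
    x ∈ hull ℝ (b '' s) ↔ ∀ k, 0 ≤ b.repr x k ∧ (k ∉ s → b.repr x k = 0) := by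
  constructor
  · intro hx
    induction hx using Submodule.span_induction with
    | mem x h =>
      obtain ⟨k, hk, rfl⟩ := h
      intro l
      by_cases hlk : k = l
      · subst hlk; simp [hk]
      · simp [hlk]
    | zero => simp
    | add x y _ _ hx hy =>
      intro k
      simp only [map_add, Finsupp.add_apply]
      exact ⟨add_nonneg (hx k).1 (hy k).1, fun h => by rw [(hx k).2 h, (hy k).2 h, add_zero]⟩
    | smul a x _ hx =>
      intro k
      have : b.repr (a • x) k = (a : ℝ) * b.repr x k := by
        exact DFunLike.congr_fun (map_smul b.repr (a : ℝ) x) k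
      rw [this]
      exact ⟨mul_nonneg a.2 (hx k).1, fun h => by rw [(hx k).2 h, mul_zero]⟩
  · intro h
    rw [← b.sum_repr x]
    refine Submodule.sum_mem _ fun k _ => ?_
    by_cases hk : k ∈ s
    · exact (hull ℝ (b '' s)).smul_mem (h k).1 (Submodule.subset_span ⟨k, hk, rfl⟩)
    · rw [(h k).2 hk, zero_smul]
      exact Submodule.zero_mem _

end PointedCone


theorem Module.Basis.isPrimitiveVector {V : Type*} [AddCommGroup V] {N : Submodule ℤ V}
    {ι : Type*} (b : Module.Basis ι ℤ N) (k : ι) : IsPrimitiveVector N (b k : V) := by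
  refine ⟨(b k).2, ?_, ?_⟩
  · simpa using b.ne_zero k
  · intro c w hw h
    have h1 : b k = c • (⟨w, hw⟩ : N) := Subtype.ext h
    have h2 := congrArg (fun x => b.repr x k) h1
    simp only [repr_self, Finsupp.single_eq_same, map_smul, Finsupp.smul_apply, smul_eq_mul] at h2
    exact .of_mul_eq_one _ h2.symm

/-! ### Simplices and cones of a unimodular fan -/

namespace ConeFan

variable {V : Type*} [NormedAddCommGroup V] [NormedSpace ℝ V]
  {N : Submodule ℤ V} [DiscreteTopology N] {Δ : ConeFan V}

theorem mem_rayGenerators {v : V} :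
    v ∈ Δ.rayGenerators N ↔ IsPrimitiveVector N v ∧ hull ℝ {v} ∈ Δ.cones := by
  simp [rayGenerators]

theorem mem_simplices {k : ℕ} {I : Finset V} :
    I ∈ Δ.simplices N k ↔
      I ⊆ Δ.rayGenerators N ∧ I.card = k ∧ hull ℝ (I : Set V) ∈ Δ.cones := by
  simp [simplices, and_assoc]

/-- A ray generator in a cone of the fan that is spanned by primitive vectors is one of them. -/
theorem mem_of_mem_hull {S : Finset V} (hS : ∀ v ∈ S, IsPrimitiveVector N v)
    (hσ : hull ℝ (S : Set V) ∈ Δ.cones) {v : V} (hv : v ∈ Δ.rayGenerators N)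
    (hvS : v ∈ hull ℝ (S : Set V)) : v ∈ S := by
  obtain ⟨hvp, hvc⟩ := mem_rayGenerators.1 hv
  have hle : hull ℝ {v} ≤ hull ℝ (S : Set V) :=
    Submodule.span_le.2 (Set.singleton_subset_iff.2 hvS)
  have hface : (hull ℝ {v}).IsFaceOf (hull ℝ (S : Set V)) := by
    have := (Δ.inf_isFaceOf _ hvc _ hσ).2
    rwa [inf_eq_left.2 hle] at this
  obtain ⟨c, hc, hsum⟩ := mem_hull_finset.1 hvS
  -- A generator used with positive coefficient lies on the face, here the ray of `v`; two primitive
  -- vectors on one ray coincide.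
  obtain ⟨w, hw, hcw⟩ : ∃ w ∈ S, 0 < c w := by
    by_contra! h
    apply hvp.2.1
    rw [← hsum]
    exact Finset.sum_eq_zero fun w hw => by rw [le_antisymm (h w hw) (hc w), zero_smul]
  have hwv : w ∈ hull ℝ {v} := hface.mem_of_sum_mem_of_pos (fun u _ => hc u)
    (by rw [hsum]; exact Submodule.subset_span rfl) hw hcw
  obtain ⟨⟨r, hr⟩, hrv⟩ := Submodule.mem_span_singleton.1 hwv
  replace hrv : r • v = w := hrv
  have hr0 : r ≠ 0 := by
    rintro rfl
    exact (hS w hw).2.1 (by rw [← hrv, zero_smul])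
  have hvw : v ∈ hull ℝ {w} := by
    refine Submodule.mem_span_singleton.2 ⟨⟨r⁻¹, inv_nonneg.2 hr⟩, ?_⟩
    change r⁻¹ • w = v
    rw [← hrv, smul_smul, inv_mul_cancel₀ hr0, one_smul]
  have : hull ℝ {v} = hull ℝ {w} := le_antisymm
    (Submodule.span_le.2 (Set.singleton_subset_iff.2 hvw))
    (Submodule.span_le.2 (Set.singleton_subset_iff.2 hwv))
  rwa [hvp.eq_of_hull_eq (hS w hw) this]

/-- A simplex whose relative interior meets a cone of the fan is a face of that cone. -/
theorem subset_of_sum_mem_hull {k l : ℕ} {I I' : Finset V} (hI : I ∈ Δ.simplices N k)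
    (hI' : I' ∈ Δ.simplices N l) {c : V → ℝ} (hc : ∀ v ∈ I, 0 < c v)
    (h : ∑ v ∈ I, c v • v ∈ hull ℝ (I' : Set V)) : I ⊆ I' := by
  rw [mem_simplices] at hI hI'
  intro v hv
  refine mem_of_mem_hull (fun w hw => (mem_rayGenerators.1 (hI'.1 hw)).1) hI'.2.2 (hI.1 hv) ?_
  have hface := (Δ.inf_isFaceOf _ hI.2.2 _ hI'.2.2).1
  refine (hface.mem_of_sum_mem_of_pos (fun w hw => (hc w hw).le) ⟨?_, h⟩ hv (hc v hv)).2
  exact Submodule.sum_mem _ fun w hw => (hull ℝ (I : Set V)).smul_mem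
    (hc w hw).le (Submodule.subset_span hw)

variable [IsZLattice ℝ N] [FiniteDimensional ℝ V]

theorem linearIndepOn_of_subset_range {ι : Type*} [Finite ι] (b : Module.Basis ι ℤ N)
    {I : Set V} (h : I ⊆ Set.range (fun k => (b k : V))) : LinearIndepOn ℝ id I := by
  have h1 := (b.ofZLatticeBasis ℝ N).linearIndependent.linearIndepOn_id
  refine h1.mono (h.trans_eq ?_)
  congr 1
  ext k
  simp

/-- Every cone of a unimodular fan is spanned by a simplex that is part of a lattice basis. -/
theorem exists_simplex_of_mem_cones (hu : Δ.IsUnimodular N) {σ : PointedCone ℝ V}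
    (hσ : σ ∈ Δ.cones) :
    ∃ I : Finset V, I ∈ Δ.simplices N I.card ∧ σ = hull ℝ (I : Set V) ∧
      ∃ b : Module.Basis (Fin (Module.finrank ℤ N)) ℤ N,
        (I : Set V) ⊆ Set.range (fun k => (b k : V)) := by
  classical
  obtain ⟨b, s, rfl⟩ := hu σ hσ
  let I : Finset V := (s.toFinite.toFinset).image (fun k => (b k : V))
  have hI : (I : Set V) = (fun k => (b k : V)) '' s := by simp [I]
  have hr : (I : Set V) ⊆ Set.range (fun k => (b k : V)) := by
    rw [hI]; exact Set.image_subset_range _ _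
  have hp : ∀ v ∈ I, IsPrimitiveVector N v := by
    intro v hv
    obtain ⟨k, rfl⟩ := hr hv
    exact b.isPrimitiveVector k
  rw [← hI] at hσ ⊢
  refine ⟨I, mem_simplices.2 ⟨fun v hv => mem_rayGenerators.2 ⟨hp v hv, ?_⟩, rfl, hσ⟩, rfl, b, hr⟩
  have := isFaceOf_hull_of_subset (linearIndepOn_of_subset_range b hr)
    (Finset.singleton_subset_iff.2 hv)
  exact Δ.face_mem _ hσ _ (by simpa using this)

/-- Unimodularity only gives some lattice basis generating the cone; by `mem_of_mem_hull` the
vertices of `I` must be among its members. -/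
theorem exists_basis_of_mem_simplices (hu : Δ.IsUnimodular N) {k : ℕ} {I : Finset V}
    (hI : I ∈ Δ.simplices N k) :
    ∃ b : Module.Basis (Fin (Module.finrank ℤ N)) ℤ N,
        (I : Set V) ⊆ Set.range (fun k => (b k : V)) := by
  rw [mem_simplices] at hI
  obtain ⟨I', hI', hh, b, hb⟩ := exists_simplex_of_mem_cones hu hI.2.2
  rw [mem_simplices] at hI'
  refine ⟨b, fun v hv => hb ?_⟩
  refine mem_of_mem_hull (fun w hw => (mem_rayGenerators.1 (hI'.1 hw)).1) hI'.2.2 (hI.1 hv) ?_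
  rw [← hh]
  exact Submodule.subset_span hv

theorem linearIndepOn_of_mem_simplices (hu : Δ.IsUnimodular N) {k : ℕ} {I : Finset V}
    (hI : I ∈ Δ.simplices N k) : LinearIndepOn ℝ id (I : Set V) := by
  obtain ⟨b, hb⟩ := exists_basis_of_mem_simplices hu hI
  exact linearIndepOn_of_subset_range b hb

theorem mem_simplices_of_subset (hu : Δ.IsUnimodular N) {k : ℕ} {I A : Finset V}
    (hI : I ∈ Δ.simplices N k) (hA : A ⊆ I) : A ∈ Δ.simplices N A.card := by
  have hi := linearIndepOn_of_mem_simplices hu hI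
  rw [mem_simplices] at hI ⊢
  exact ⟨hA.trans hI.1, rfl, Δ.face_mem _ hI.2.2 _ (isFaceOf_hull_of_subset hi hA)⟩

theorem isClosed_of_mem_cones (hu : Δ.IsUnimodular N) {σ : PointedCone ℝ V}
    (hσ : σ ∈ Δ.cones) : IsClosed (σ : Set V) := by
  obtain ⟨b, s, rfl⟩ := hu σ hσ
  have h1 : (fun k => (b k : V)) = b.ofZLatticeBasis ℝ N := by ext k; simp
  rw [h1]
  have h2 : (hull ℝ ((b.ofZLatticeBasis ℝ N) '' s) : Set V) =
      ⋂ k, {x | 0 ≤ (b.ofZLatticeBasis ℝ N).coord k x} ∩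
        {x | k ∉ s → (b.ofZLatticeBasis ℝ N).coord k x = 0} := by
    ext x
    simp only [SetLike.mem_coe, mem_hull_image_basis, Set.mem_iInter, Set.mem_inter_iff,
      Set.mem_ofPred_eq, Module.Basis.coord_apply]
  rw [h2]
  refine isClosed_iInter fun k => ?_
  have hc : Continuous ((b.ofZLatticeBasis ℝ N).coord k) :=
    LinearMap.continuous_of_finiteDimensional _
  refine (isClosed_le continuous_const hc).inter ?_
  by_cases hk : k ∈ s
  · simp [hk]
  · simpa [hk] using isClosed_eq hc continuous_const

end ConeFan

/-! ### Coordinates in a maximal simplex and the two sides of a wall -/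

namespace ConeFan

variable {V : Type*} [NormedAddCommGroup V] [NormedSpace ℝ V]
  {N : Submodule ℤ V} [DiscreteTopology N] {Δ : ConeFan V}
  [IsZLattice ℝ N] [FiniteDimensional ℝ V]

theorem exists_basis_range_eq (hu : Δ.IsUnimodular N) {I : Finset V}
    (hI : I ∈ Δ.simplices N (Module.finrank ℝ V)) :
    ∃ b : Module.Basis (Fin (Module.finrank ℤ N)) ℤ N,
        (I : Set V) = Set.range (fun k => (b k : V)) := by
  classical
  obtain ⟨b, hb⟩ := exists_basis_of_mem_simplices hu hI
  refine ⟨b, ?_⟩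
  have h1 : I ⊆ Finset.univ.image (fun k => (b k : V)) := by
    intro v hv
    simpa using hb hv
  have h2 : (Finset.univ.image (fun k => (b k : V))).card ≤ I.card := by
    refine Finset.card_image_le.trans ?_
    rw [(mem_simplices.1 hI).2.1, Finset.card_univ, Fintype.card_fin, ZLattice.rank ℝ N]
  rw [Finset.eq_of_subset_of_card_le h1 h2]
  simp

theorem span_eq_top_of_mem_simplices (hu : Δ.IsUnimodular N) {I : Finset V}
    (hI : I ∈ Δ.simplices N (Module.finrank ℝ V)) : Submodule.span ℝ (I : Set V) = ⊤ := by
  obtain ⟨b, hb⟩ := exists_basis_range_eq hu hI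
  rw [hb, ← (b.ofZLatticeBasis ℝ N).span_eq]
  congr 1
  ext k
  simp

theorem linearMap_ext_of_mem_simplices (hu : Δ.IsUnimodular N) {I : Finset V}
    (hI : I ∈ Δ.simplices N (Module.finrank ℝ V)) {f g : V →ₗ[ℝ] ℝ} (h : ∀ v ∈ I, f v = g v) :
    f = g :=
  LinearMap.ext_on (span_eq_top_of_mem_simplices hu hI) h

open Classical in
/-- The coordinate of a vector at the element `v` of a basis `I`. -/
noncomputable def coord (I : Finset V) (v : V) : V →ₗ[ℝ] ℝ :=
  if h : ∃ f : V →ₗ[ℝ] ℝ, f v = 1 ∧ ∀ w ∈ I, w ≠ v → f w = 0 then h.choose else 0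

theorem coord_spec (hu : Δ.IsUnimodular N) {I : Finset V}
    (hI : I ∈ Δ.simplices N (Module.finrank ℝ V)) {v : V} (hv : v ∈ I) :
    coord I v v = 1 ∧ ∀ w ∈ I, w ≠ v → coord I v w = 0 := by
  have h : ∃ f : V →ₗ[ℝ] ℝ, f v = 1 ∧ ∀ w ∈ I, w ≠ v → f w = 0 := by
    obtain ⟨b, hb⟩ := exists_basis_range_eq hu hI
    obtain ⟨k, rfl⟩ : v ∈ Set.range (fun k => (b k : V)) := hb ▸ hv
    refine ⟨(b.ofZLatticeBasis ℝ N).coord k, ?_, ?_⟩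
    · dsimp only
      rw [← b.ofZLatticeBasis_apply ℝ N k, Module.Basis.coord_apply, Module.Basis.repr_self]
      simp
    · intro w hw hne
      obtain ⟨l, rfl⟩ : w ∈ Set.range (fun k => (b k : V)) := hb ▸ hw
      have hlk : l ≠ k := fun h => hne (by rw [h])
      dsimp only
      rw [← b.ofZLatticeBasis_apply ℝ N l, Module.Basis.coord_apply, Module.Basis.repr_self]
      simp [hlk]
  rw [coord, dif_pos h]
  exact h.choose_spec

theorem coord_eq_of_mem_simplices (hu : Δ.IsUnimodular N) {I : Finset V}
    (hI : I ∈ Δ.simplices N (Module.finrank ℝ V)) {v : V} (hv : v ∈ I) {f : V →ₗ[ℝ] ℝ}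
    (h1 : f v = 1) (h0 : ∀ w ∈ I, w ≠ v → f w = 0) : coord I v = f := by
  obtain ⟨h3, h4⟩ := coord_spec hu hI hv
  refine linearMap_ext_of_mem_simplices hu hI fun w hw => ?_
  by_cases hwv : w = v
  · rw [hwv, h1, h3]
  · rw [h0 w hw hwv, h4 w hw hwv]

theorem apply_eq_sum_coord (hu : Δ.IsUnimodular N) {I : Finset V}
    (hI : I ∈ Δ.simplices N (Module.finrank ℝ V)) (f : V →ₗ[ℝ] ℝ) (x : V) :
    f x = ∑ v ∈ I, coord I v x * f v := by
  have : f = ∑ v ∈ I, f v • coord I v := by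
    refine linearMap_ext_of_mem_simplices hu hI fun w hw => ?_
    rw [LinearMap.sum_apply, Finset.sum_eq_single w]
    · simp [(coord_spec hu hI hw).1]
    · intro v hv hvw
      simp [(coord_spec hu hI hv).2 w hw hvw.symm]
    · exact fun h => (h hw).elim
  conv_lhs => rw [this]
  simp [LinearMap.sum_apply, mul_comm]

theorem sum_coord_smul (hu : Δ.IsUnimodular N) {I : Finset V}
    (hI : I ∈ Δ.simplices N (Module.finrank ℝ V)) (x : V) :
    ∑ v ∈ I, coord I v x • v = x := by
  have : ∑ v ∈ I, (coord I v).smulRight v = LinearMap.id := by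
    refine LinearMap.ext_on (span_eq_top_of_mem_simplices hu hI) fun w hw => ?_
    rw [LinearMap.sum_apply, Finset.sum_eq_single w]
    · simp [(coord_spec hu hI hw).1]
    · intro v hv hvw
      simp [(coord_spec hu hI hv).2 w hw hvw.symm]
    · exact fun h => (h hw).elim
  simpa [LinearMap.sum_apply] using LinearMap.congr_fun this x

/-- Some maximal simplex lies on the positive side of a wall. -/
theorem exists_insert_mem_simplices [DecidableEq V] (hc : Δ.IsComplete) (hu : Δ.IsUnimodular N)
    {k : ℕ} {J : Finset V} (hJ : J ∈ Δ.simplices N k) {f : V →ₗ[ℝ] ℝ} (hf : ∀ v ∈ J, f v = 0)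
    {x : V} (hx : 0 < f x) : ∃ i, 0 < f i ∧ insert i J ∈ Δ.simplices N (k + 1) := by
  -- Push an interior point of the wall towards `x`. Finitely many cones cover the path, so one of
  -- them contains points with arbitrarily small `t`; being closed, it also contains the starting
  -- point.
  have hpx : ∃ σ ∈ Δ.cones, ∃ᶠ t : ℝ in 𝓝[>] 0, ∑ v ∈ J, v + t • x ∈ σ := by
    by_contra h
    push Not at h
    obtain ⟨t, ht⟩ := ((Filter.eventually_all_finset _).2 h).exists
    obtain ⟨σ, hσ, hσt⟩ := hc (∑ v ∈ J, v + t • x)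
    exact ht σ hσ hσt
  obtain ⟨σ, hσ, hfr⟩ := hpx
  have hp : ∑ v ∈ J, v ∈ σ := by
    refine (isClosed_of_mem_cones hu hσ).mem_of_frequently_of_tendsto hfr ?_
    have : Tendsto (fun t : ℝ => ∑ v ∈ J, v + t • x) (𝓝 0) (𝓝 (∑ v ∈ J, v + (0 : ℝ) • x)) :=
      Continuous.tendsto (by fun_prop) 0
    rw [zero_smul, add_zero] at this
    exact this.mono_left nhdsWithin_le_nhds
  obtain ⟨I, hI, rfl, -⟩ := exists_simplex_of_mem_cones hu hσ
  have hJI : J ⊆ I := subset_of_sum_mem_hull hJ hI (c := fun _ => 1)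
    (fun _ _ => one_pos) (by simpa using hp)
  obtain ⟨t, ht, ht0⟩ := (hfr.and_eventually self_mem_nhdsWithin).exists
  have ht0 : 0 < t := ht0
  obtain ⟨c, hc0, hsum⟩ := mem_hull_finset.1 ht
  have hpos : 0 < ∑ v ∈ I, c v * f v := by
    have := congrArg f hsum
    simp only [map_sum, map_smul, map_add, smul_eq_mul] at this
    rw [this, Finset.sum_eq_zero hf]
    positivity
  obtain ⟨i, hi, hfi⟩ : ∃ i ∈ I, 0 < f i := by
    by_contra! h
    exact hpos.not_ge (Finset.sum_nonpos fun v hv => mul_nonpos_of_nonneg_of_nonpos (hc0 v) (h v hv))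
  refine ⟨i, hfi, ?_⟩
  have hiJ : i ∉ J := fun h => hfi.ne' (hf i h)
  have := mem_simplices_of_subset hu hI (Finset.insert_subset hi hJI)
  rwa [Finset.card_insert_of_notMem hiJ, (mem_simplices.1 hJ).2.1] at this

/-- At most one maximal simplex lies on the positive side of a wall. -/
theorem eq_of_insert_mem_simplices [DecidableEq V] (hu : Δ.IsUnimodular N) {J : Finset V} {i i' : V}
    (hi : insert i J ∈ Δ.simplices N (Module.finrank ℝ V))
    (hi' : insert i' J ∈ Δ.simplices N (Module.finrank ℝ V))
    {f : V →ₗ[ℝ] ℝ} (hf : ∀ v ∈ J, f v = 0) (hfi : 0 < f i) (hfi' : 0 < f i') : i = i' := by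
  have hiJ : i ∉ J := fun h => hfi.ne' (hf i h)
  set b : V → ℝ := fun v => coord (insert i J) v i' with hb
  have hsum := sum_coord_smul hu hi i'
  rw [Finset.sum_insert hiJ] at hsum
  have hα : 0 < b i := by
    have := congrArg f hsum
    rw [map_add, map_sum, Finset.sum_eq_zero (fun v hv => by simp [hf v hv]), add_zero, map_smul,
      smul_eq_mul] at this
    exact pos_of_mul_pos_left (this ▸ hfi') hfi.le
  have hε : ∀ᶠ ε : ℝ in 𝓝[>] 0, ∀ v ∈ J, 0 < 1 + ε * b v := by
    refine (Filter.eventually_all_finset _).2 fun v _ => ?_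
    have : Tendsto (fun ε : ℝ => 1 + ε * b v) (𝓝 0) (𝓝 (1 + 0 * b v)) :=
      Continuous.tendsto (by fun_prop) 0
    refine (this.mono_left nhdsWithin_le_nhds).eventually (lt_mem_nhds ?_)
    simp
  obtain ⟨ε, hε, hε0⟩ := (hε.and self_mem_nhdsWithin).exists
  have hε0 : 0 < ε := hε0
  -- For small `ε` the point `∑ v ∈ J, v + ε • i'` of the second cone has only positive coordinates
  -- in the first, so it is in the relative interior of the first.
  have hsub := subset_of_sum_mem_hull hi hi'
    (c := fun v => if v = i then ε * b i else 1 + ε * b v) ?_ ?_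
  · rcases Finset.mem_insert.1 (hsub (Finset.mem_insert_self i J)) with h | h
    · exact h
    · exact (hiJ h).elim
  · intro v hv
    split_ifs with h
    · positivity
    · exact hε v (Finset.mem_of_mem_insert_of_ne hv h)
  · have : ∑ v ∈ insert i J, (if v = i then ε * b i else 1 + ε * b v) • v =
        ∑ v ∈ J, v + ε • i' := by
      rw [Finset.sum_insert hiJ, if_pos rfl, ← hsum, smul_add, Finset.smul_sum, mul_smul,
        add_left_comm, ← Finset.sum_add_distrib]
      congr 1
      refine Finset.sum_congr rfl fun v hv => ?_
      rw [if_neg (ne_of_mem_of_not_mem hv hiJ), add_smul, one_smul, mul_smul]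
    rw [this]
    refine Submodule.add_mem _ (Submodule.sum_mem _ fun v hv =>
      Submodule.subset_span (Finset.mem_insert_of_mem hv)) ?_
    exact (hull ℝ _).smul_mem hε0.le (Submodule.subset_span (Finset.mem_insert_self i' J))

/-- The two maximal simplices at a wall, on the two sides of a hyperplane `f = 0`. -/
theorem exists_wall_sides [DecidableEq V] (hc : Δ.IsComplete) (hu : Δ.IsUnimodular N)
    (hn : 0 < Module.finrank ℝ V) {J : Finset V} (hJ : J ∈ Δ.walls N) :
    ∃ (i i' : V) (a : V → ℤ) (f : V →ₗ[ℝ] ℝ), (∀ v ∈ J, f v = 0) ∧ f i = 1 ∧ f i' = -1 ∧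
      insert i J ∈ Δ.simplices N (Module.finrank ℝ V) ∧
      insert i' J ∈ Δ.simplices N (Module.finrank ℝ V) ∧
      i' = (∑ j ∈ J, a j • j) - i ∧
      ∀ k, insert k J ∈ Δ.simplices N (Module.finrank ℝ V) → k = i ∨ k = i' := by
  have hJ' : J ∈ Δ.simplices N (Module.finrank ℝ V - 1) := hJ
  obtain ⟨b, hb⟩ := exists_basis_of_mem_simplices hu hJ'
  have hbinj : Function.Injective (fun k => (b k : V)) :=
    fun k l h => b.injective (Subtype.ext h)
  obtain ⟨k, hk⟩ : ∃ k, Finset.univ.image (fun k => (b k : V)) \ J = {(b k : V)} := by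
    have h1 : J ⊆ Finset.univ.image (fun k => (b k : V)) := by
      intro v hv
      simpa using hb hv
    have h2 : (Finset.univ.image (fun k => (b k : V)) \ J).card = 1 := by
      rw [Finset.card_sdiff_of_subset h1, Finset.card_image_of_injective _ hbinj, Finset.card_univ,
        Fintype.card_fin, ZLattice.rank ℝ N, (mem_simplices.1 hJ').2.1]
      omega
    obtain ⟨v, hv⟩ := Finset.card_eq_one.1 h2
    have hv' : v ∈ Finset.univ.image (fun k => (b k : V)) \ J := by simp [hv]
    obtain ⟨k, -, rfl⟩ := Finset.mem_image.1 (Finset.mem_sdiff.1 hv').1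
    exact ⟨k, hv⟩
  have hkJ : (b k : V) ∉ J := by
    have : (b k : V) ∈ Finset.univ.image (fun k => (b k : V)) \ J := by simp [hk]
    exact (Finset.mem_sdiff.1 this).2
  have hlJ : ∀ l, l ≠ k → (b l : V) ∈ J := by
    intro l hl
    by_contra h
    have : (b l : V) ∈ Finset.univ.image (fun k => (b k : V)) \ J := by simp [h]
    rw [hk, Finset.mem_singleton] at this
    exact hl (hbinj this)
  set f : V →ₗ[ℝ] ℝ := (b.ofZLatticeBasis ℝ N).coord k with hfdef
  have hfN : ∀ x : N, f x = b.repr x k := by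
    intro x
    rw [hfdef, Module.Basis.coord_apply, b.ofZLatticeBasis_repr_apply ℝ N]
  have hfJ : ∀ v ∈ J, f v = 0 := by
    intro v hv
    obtain ⟨l, rfl⟩ := hb hv
    have : l ≠ k := by rintro rfl; exact hkJ hv
    simp [hfN, this]
  have hfk : f (b k : V) = 1 := by simp [hfN]
  have hn' : Module.finrank ℝ V - 1 + 1 = Module.finrank ℝ V := by omega
  -- Expand `b k` in the lattice basis `insert i J` and apply `f`, which is integral on `N`: 1 is an
  -- integer multiple of the integer `f i`.
  have hunit : ∀ i, insert i J ∈ Δ.simplices N (Module.finrank ℝ V) → f i = 1 ∨ f i = -1 := by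
    intro i hi
    obtain ⟨b', hb'⟩ := exists_basis_range_eq hu hi
    obtain ⟨l, hl⟩ : i ∈ Set.range (fun k => (b' k : V)) := by
      rw [← hb']; simp
    have h0 : ∀ l', l' ≠ l → f (b' l' : V) = 0 := by
      intro l' hl'
      have : (b' l' : V) ∈ insert i J := by
        have : (b' l' : V) ∈ Set.range (fun k => (b' k : V)) := ⟨l', rfl⟩
        rw [← hb'] at this
        exact this
      refine hfJ _ (Finset.mem_of_mem_insert_of_ne this fun h => hl' ?_)
      exact b'.injective (Subtype.ext (h.trans hl.symm))
    have h1 : f (b k : V) = b'.repr (b k) l * f i := by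
      have h2 := congrArg (fun x : N => (x : V)) (b'.sum_repr (b k))
      rw [← h2, Submodule.coe_sum, map_sum, Finset.sum_eq_single l]
      · rw [Submodule.coe_smul, ← hl, ← Int.cast_smul_eq_zsmul ℝ, map_smul, smul_eq_mul]
      · intro l' _ hl'
        rw [Submodule.coe_smul, ← Int.cast_smul_eq_zsmul ℝ, map_smul, h0 l' hl', smul_zero]
      · simp
    have hiN : f i = b.repr (b' l) k := by rw [← hl]; exact hfN _
    rw [hfk, hiN] at h1
    have h3 : IsUnit (b.repr (b' l) k) := .of_mul_eq_one_right _ (by exact_mod_cast h1.symm)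
    rw [hiN]
    rcases Int.isUnit_iff.1 h3 with h | h <;> simp [h]
  obtain ⟨i, hi0, hi⟩ := exists_insert_mem_simplices hc hu hJ' hfJ (x := (b k : V)) (by simp [hfk])
  obtain ⟨i', hi0', hi'⟩ := exists_insert_mem_simplices hc hu hJ' (f := -f)
    (fun v hv => by simp [hfJ v hv]) (x := -(b k : V)) (by simp [hfk])
  rw [LinearMap.neg_apply, neg_pos] at hi0'
  rw [hn'] at hi hi'
  have hfi : f i = 1 := (hunit i hi).resolve_right (by linarith)
  have hfi' : f i' = -1 := (hunit i' hi').resolve_left (by linarith)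
  have hiN : i ∈ N := (mem_rayGenerators.1 ((mem_simplices.1 hi).1 (by simp))).1.1
  have hiN' : i' ∈ N := (mem_rayGenerators.1 ((mem_simplices.1 hi').1 (by simp))).1.1
  -- `f` is the coordinate at the only basis vector outside `J`, and `f (i' + i) = -1 + 1 = 0`.
  have hspan : i' + i ∈ Submodule.span ℤ (J : Set V) := by
    let x : N := ⟨i' + i, N.add_mem hiN' hiN⟩
    have hx : (x : V) = i' + i := rfl
    have h2 := congrArg (fun x : N => (x : V)) (b.sum_repr x)
    rw [← hx, ← h2, Submodule.coe_sum]
    refine Submodule.sum_mem _ fun l _ => ?_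
    rw [Submodule.coe_smul]
    by_cases hl : l = k
    · have : b.repr x k = 0 := by
        have := hfN x
        rw [hx, map_add, hfi, hfi'] at this
        exact_mod_cast (show (b.repr x k : ℝ) = 0 by linarith)
      rw [hl, this, zero_smul]
      exact Submodule.zero_mem _
    · exact Submodule.smul_mem _ _ (Submodule.subset_span (hlJ l hl))
  obtain ⟨a, -, ha⟩ := Submodule.mem_span_finset.1 hspan
  refine ⟨i, i', a, f, hfJ, hfi, hfi', hi, hi', by rw [ha, add_sub_cancel_right], ?_⟩
  intro l hl
  rcases lt_trichotomy (f l) 0 with h | h | h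
  · right
    exact eq_of_insert_mem_simplices hu hl hi' (f := -f) (fun v hv => by simp [hfJ v hv])
      (by simpa using h) (by simp [hfi'])
  · exfalso
    have : f = 0 := by
      refine linearMap_ext_of_mem_simplices hu hl fun v hv => ?_
      rcases Finset.mem_insert.1 hv with rfl | hv
      · simpa using h
      · simpa using hfJ v hv
    rw [this] at hfk
    simp at hfk
  · left
    exact eq_of_insert_mem_simplices hu hl hi hfJ h (by simp [hfi])

end ConeFan

/-! ### Jumps of step functions along a path -/

/-- The indicator function of the positive reals. -/
noncomputable def posStep (x : ℝ) : ℝ := if 0 < x then 1 else 0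

theorem posStep_of_pos {x : ℝ} (h : 0 < x) : posStep x = 1 := if_pos h

theorem posStep_of_nonpos {x : ℝ} (h : x ≤ 0) : posStep x = 0 := if_neg h.not_gt

theorem posStep_neg {x : ℝ} (h : x ≠ 0) : posStep (-x) = 1 - posStep x := by
  rcases h.lt_or_gt with h | h
  · rw [posStep_of_nonpos h.le, posStep_of_pos (by linarith)]; norm_num
  · rw [posStep_of_pos h, posStep_of_nonpos (by linarith)]; norm_num

/-- Follow `x + s * y` for `s > 0`, from the sign of `x` to that of `y`. By `hD` it vanishes at the
positive time `s = -x / y`. At that time `x' + s * y'` still has the sign of `x'` if its own zero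
`-x' / y'` comes later, and has the sign of `y'` otherwise. -/
theorem posStep_sub_div_mul {x y x' y' : ℝ} (hx : x ≠ 0) (hy : y ≠ 0) (hy' : y' ≠ 0)
    (h : x' * y - x * y' ≠ 0) (hD : posStep x - posStep y ≠ 0) :
    posStep (x' - x / y * y') = if -x / y < -x' / y' then posStep x' else posStep y' := by
  have hs : 0 < -x / y := by
    rcases hx.lt_or_gt with h1 | h1 <;> rcases hy.lt_or_gt with h2 | h2
    · simp [posStep_of_nonpos h1.le, posStep_of_nonpos h2.le] at hD
    · exact div_pos (by linarith) h2
    · exact div_pos_of_neg_of_neg (by linarith) h2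
    · simp [posStep_of_pos h1, posStep_of_pos h2] at hD
  set s := -x / y with hsdef
  set s' := -x' / y' with hsdef'
  have hx' : x' = -s' * y' := by rw [hsdef']; field_simp
  have hxs : x = -s * y := by rw [hsdef]; field_simp
  have h1 : x' - x / y * y' = y' * (s - s') := by rw [hx', hxs]; field_simp; ring
  have hne : s ≠ s' := by
    intro hss
    apply h
    rw [hx', hxs, hss]; ring
  rw [h1]
  split_ifs with hlt
  · rcases hy'.lt_or_gt with h2 | h2
    · rw [posStep_of_pos (by nlinarith), posStep_of_pos (by rw [hx']; nlinarith)]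
    · rw [posStep_of_nonpos (by nlinarith), posStep_of_nonpos (by rw [hx']; nlinarith)]
  · have hlt' : s' < s := lt_of_le_of_ne (not_lt.1 hlt) hne.symm
    rcases hy'.lt_or_gt with h2 | h2
    · rw [posStep_of_nonpos (by nlinarith), posStep_of_nonpos h2.le]
    · rw [posStep_of_pos (by nlinarith), posStep_of_pos h2]

/-- A telescoping sum: replace `xᵢ` by `yᵢ` one index at a time, in the order of the times `sᵢ`. -/
theorem mul_sub_mul_eq_of_ordered {s₁ s₂ s₃ : ℝ} (h₁₂ : s₁ ≠ s₂) (h₁₃ : s₁ ≠ s₃) (h₂₃ : s₂ ≠ s₃)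
    (x₁ x₂ x₃ y₁ y₂ y₃ b₁ b₂ b₃ : ℝ) :
    (x₁ - b₁) * (x₂ - b₂) * (x₃ - b₃) - (y₁ - b₁) * (y₂ - b₂) * (y₃ - b₃) =
      (x₁ - y₁) * (((if s₁ < s₂ then x₂ else y₂) - b₂) * ((if s₁ < s₃ then x₃ else y₃) - b₃)) +
      (x₂ - y₂) * (((if s₂ < s₁ then x₁ else y₁) - b₁) * ((if s₂ < s₃ then x₃ else y₃) - b₃)) +
      (x₃ - y₃) *
        (((if s₃ < s₁ then x₁ else y₁) - b₁) * ((if s₃ < s₂ then x₂ else y₂) - b₂)) := by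
  rcases h₁₂.lt_or_gt with h1 | h1 <;> rcases h₁₃.lt_or_gt with h2 | h2 <;>
    rcases h₂₃.lt_or_gt with h3 | h3 <;> first | (exfalso; linarith) | skip
  all_goals
    simp only [h1, h2, h3, h1.not_gt, h2.not_gt, h3.not_gt, if_true, if_false]
    ring

/-- The change of a product of three step functions along a line is the sum of its jumps. -/
theorem posStep_mul_sub_posStep_mul {x₁ x₂ x₃ y₁ y₂ y₃ : ℝ} (hx₁ : x₁ ≠ 0) (hx₂ : x₂ ≠ 0)
    (hx₃ : x₃ ≠ 0) (hy₁ : y₁ ≠ 0) (hy₂ : y₂ ≠ 0) (hy₃ : y₃ ≠ 0) (h₁₂ : x₁ * y₂ - x₂ * y₁ ≠ 0)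
    (h₁₃ : x₁ * y₃ - x₃ * y₁ ≠ 0) (h₂₃ : x₂ * y₃ - x₃ * y₂ ≠ 0) (b₁ b₂ b₃ : ℝ) :
    (posStep x₁ - b₁) * (posStep x₂ - b₂) * (posStep x₃ - b₃) -
        (posStep y₁ - b₁) * (posStep y₂ - b₂) * (posStep y₃ - b₃) =
      (posStep x₁ - posStep y₁) *
        ((posStep (x₂ - x₁ / y₁ * y₂) - b₂) * (posStep (x₃ - x₁ / y₁ * y₃) - b₃)) +
      (posStep x₂ - posStep y₂) *
        ((posStep (x₁ - x₂ / y₂ * y₁) - b₁) * (posStep (x₃ - x₂ / y₂ * y₃) - b₃)) +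
      (posStep x₃ - posStep y₃) *
        ((posStep (x₁ - x₃ / y₃ * y₁) - b₁) * (posStep (x₂ - x₃ / y₃ * y₂) - b₂)) := by
  have key : ∀ {x y x' y' : ℝ}, x ≠ 0 → y ≠ 0 → y' ≠ 0 → x * y' - x' * y ≠ 0 →
      -x / y ≠ -x' / y' := by
    intro x y x' y' _ hy hy' h he
    rw [div_eq_div_iff hy hy'] at he
    exact h (by linarith)
  -- If the coordinate does not change sign, its crossing time is not positive and the signs there
  -- are not controlled, but the jump factor is zero.
  have key2 : ∀ {x y x' y' x'' y'' : ℝ} (b' b'' : ℝ), x ≠ 0 → y ≠ 0 → y' ≠ 0 → y'' ≠ 0 →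
      x' * y - x * y' ≠ 0 → x'' * y - x * y'' ≠ 0 →
      (posStep x - posStep y) *
        ((posStep (x' - x / y * y') - b') * (posStep (x'' - x / y * y'') - b'')) =
      (posStep x - posStep y) *
        (((if -x / y < -x' / y' then posStep x' else posStep y') - b') *
          ((if -x / y < -x'' / y'' then posStep x'' else posStep y'') - b'')) := by
    intro x y x' y' x'' y'' b' b'' hx hy hy' hy'' h h'
    by_cases hD : posStep x - posStep y = 0
    · rw [hD, zero_mul, zero_mul]
    · rw [posStep_sub_div_mul hx hy hy' h hD, posStep_sub_div_mul hx hy hy'' h' hD]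
  have sw : ∀ {x y x' y' : ℝ}, x * y' - x' * y ≠ 0 → x' * y - x * y' ≠ 0 :=
    fun h h' => h (by linarith)
  rw [key2 _ _ hx₁ hy₁ hy₂ hy₃ (sw h₁₂) (sw h₁₃), key2 _ _ hx₂ hy₂ hy₁ hy₃ h₁₂ (sw h₂₃),
    key2 _ _ hx₃ hy₃ hy₁ hy₂ h₁₃ h₂₃]
  exact mul_sub_mul_eq_of_ordered (key hx₁ hy₁ hy₂ h₁₂) (key hx₁ hy₁ hy₃ h₁₃) (key hx₂ hy₂ hy₃ h₂₃)
    _ _ _ _ _ _ _ _ _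

/-! ### Lattice expansion of 1/(1 - e^{-n}) -/

/-- The weight selects the convergent geometric series: `k ≥ 0` with sign + if `n > 0`, and `k < 0`
with sign - if `n < 0`. One formula for both signs lets the coefficients from different cones be
added. -/
theorem hasSum_int_posStep_sub_mul_exp {n : ℝ} (hn : n ≠ 0) :
    HasSum (fun k : ℤ => (posStep n - if k < 0 then 1 else 0) * Real.exp (-(n * k)))
      (1 / (1 - Real.exp (-n))) := by
  have hpow : ∀ (x : ℝ) (j : ℕ), Real.exp (-(x * j)) = Real.exp (-x) ^ j := by
    intro x j
    rw [← Real.exp_nat_mul]; ring_nf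
  set f : ℤ → ℝ := fun k : ℤ => (posStep n - if k < 0 then 1 else 0) * Real.exp (-(n * k)) with hf
  rcases hn.lt_or_gt with h | h
  · have h1 : Real.exp n < 1 := by simpa using h
    have h2 := (hasSum_geometric_of_lt_one (Real.exp_pos n).le h1).mul_left (-Real.exp n)
    have h3 : HasSum (fun j : ℕ => f (-(j + 1 : ℤ))) (-Real.exp n * (1 - Real.exp n)⁻¹) := by
      refine h2.congr_fun fun j => ?_
      have h5 : Real.exp (-(n * ((-(j + 1 : ℤ) : ℤ) : ℝ))) = Real.exp n * Real.exp n ^ j := by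
        rw [← Real.exp_nat_mul, ← Real.exp_add]
        push_cast
        ring_nf
      simp only [hf]
      rw [h5, posStep_of_nonpos h.le, if_pos (by omega)]
      ring
    have h4 : HasSum (fun j : ℕ => f (j : ℤ)) 0 := by
      refine hasSum_zero.congr_fun fun j => ?_
      simp only [hf]
      rw [posStep_of_nonpos h.le, if_neg (by omega), sub_zero, zero_mul]
    have h6 := h4.of_nat_of_neg_add_one h3
    have h7 : (0 : ℝ) + -Real.exp n * (1 - Real.exp n)⁻¹ = 1 / (1 - Real.exp (-n)) := by
      have h8 := Real.exp_pos n
      have h9 : 1 - Real.exp n ≠ 0 := by linarith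
      have h10 : Real.exp n - 1 ≠ 0 := by linarith
      have h11 : 1 - (Real.exp n)⁻¹ = (Real.exp n - 1) / Real.exp n := by field_simp
      rw [Real.exp_neg, h11]
      field_simp
      ring
    rwa [h7] at h6
  · have h1 : Real.exp (-n) < 1 := by simpa using h
    have h2 := hasSum_geometric_of_lt_one (Real.exp_pos (-n)).le h1
    have h3 : HasSum (fun j : ℕ => f (j : ℤ)) (1 - Real.exp (-n))⁻¹ := by
      refine h2.congr_fun fun j => ?_
      simp only [hf]
      rw [posStep_of_pos h, if_neg (by omega), sub_zero, one_mul, ← hpow]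
      simp
    have h4 : HasSum (fun j : ℕ => f (-(j + 1 : ℤ))) 0 := by
      refine hasSum_zero.congr_fun fun j => ?_
      simp only [hf]
      rw [posStep_of_pos h, if_pos (by omega), sub_self, zero_mul]
    have h6 := h3.of_nat_of_neg_add_one h4
    rwa [add_zero, ← one_div] at h6

theorem hasSum_prod_mul {α β : Type*} {f : α → ℝ} {g : β → ℝ} {a b : ℝ} (hf : HasSum f a)
    (hg : HasSum g b) : HasSum (fun x : α × β => f x.1 * g x.2) (a * b) :=
  hf.mul hg (summable_mul_of_summable_norm hf.summable.norm hg.summable.norm)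

theorem hasSum_pi_prod {β : Type*} {n : ℕ} {f : Fin n → β → ℝ} {a : Fin n → ℝ}
    (h : ∀ i, HasSum (f i) (a i)) : HasSum (fun z : Fin n → β => ∏ i, f i (z i)) (∏ i, a i) := by
  induction n with
  | zero => simp
  | succ n ih =>
    have h1 := ih fun i : Fin n => h i.succ
    have h2 := hasSum_prod_mul (h 0) h1
    rw [Fin.prod_univ_succ, ← (Fin.consEquiv fun _ => β).hasSum_iff]
    refine h2.congr_fun fun z => ?_
    simp [Fin.consEquiv, Fin.prod_univ_succ]

/-! ### Laurent expansions at 0 -/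

/-- The Laurent expansion of `1 / (1 - exp (-x))` at `0`. -/
theorem abs_one_div_one_sub_exp_sub_le {x : ℝ} (hx : x ≠ 0) (hx1 : |x| ≤ 1 / 2) :
    |1 / (1 - Real.exp (-x)) - (1 / x + 1 / 2 + x / 12)| ≤ |x| ^ 3 := by
  -- Order 5 suffices: the error `x ^ 5` is later divided by `12 * x * q`, which is of size `x ^ 2`.
  have h := Real.exp_bound (x := -x) (n := 5) (by rw [abs_neg]; linarith) (by norm_num)
  rw [abs_neg] at h
  set δ := Real.exp (-x) - ∑ m ∈ Finset.range 5, (-x) ^ m / m.factorial with hδ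
  have hexp : Real.exp (-x) = 1 - x + x ^ 2 / 2 - x ^ 3 / 6 + x ^ 4 / 24 + δ := by
    rw [hδ]
    simp only [Finset.sum_range_succ, Finset.sum_range_zero, Nat.factorial]
    push_cast
    ring
  have hδ1 : |δ| ≤ |x| ^ 5 / 100 := by
    refine h.trans_eq ?_
    simp only [Nat.factorial]
    push_cast
    ring
  have hp : 0 < |x| := abs_pos.2 hx
  set q := 1 - Real.exp (-x) with hq
  have hq1 : |x| / 2 ≤ |q| := by
    have h1 : x = q + (x ^ 2 / 2 - x ^ 3 / 6 + x ^ 4 / 24 + δ) := by rw [hq, hexp]; ring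
    have h2 : |x ^ 2 / 2 - x ^ 3 / 6 + x ^ 4 / 24 + δ| ≤
        |x| ^ 2 / 2 + |x| ^ 3 / 6 + |x| ^ 4 / 24 + |x| ^ 5 / 100 := by
      refine (abs_add_le _ _).trans (add_le_add ((abs_add_le _ _).trans
        (add_le_add ((abs_sub _ _).trans (add_le_add ?_ ?_)) ?_)) hδ1) <;>
      simp [abs_div, abs_pow]
    have h3 : |x| ≤ |q| + |x ^ 2 / 2 - x ^ 3 / 6 + x ^ 4 / 24 + δ| := by
      conv_lhs => rw [h1]
      exact abs_add_le _ _
    have h4 : |x| ^ 2 ≤ |x| * (1 / 2) := by nlinarith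
    have h5 : |x| ^ 3 ≤ |x| * (1 / 4) := by nlinarith
    have h6 : |x| ^ 4 ≤ |x| * (1 / 8) := by nlinarith
    have h7 : |x| ^ 5 ≤ |x| * (1 / 16) := by nlinarith
    linarith
  have hq0 : q ≠ 0 := abs_pos.1 (by linarith)
  have hnum : 1 / q - (1 / x + 1 / 2 + x / 12) =
      (x ^ 5 / 12 + x ^ 6 / 24 + (12 + 6 * x + x ^ 2) * δ) / (12 * x * q) := by
    rw [eq_div_iff (by positivity)]
    have h1 : q = x - x ^ 2 / 2 + x ^ 3 / 6 - x ^ 4 / 24 - δ := by rw [hq, hexp]; ring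
    have h2 : (1 / q - (1 / x + 1 / 2 + x / 12)) * (12 * x * q) =
      12 * x - (12 + 6 * x + x ^ 2) * q := by
      field_simp
      ring
    rw [h2, h1]
    ring
  rw [hnum, abs_div, div_le_iff₀ (by positivity)]
  have h1 : |x ^ 5 / 12 + x ^ 6 / 24 + (12 + 6 * x + x ^ 2) * δ| ≤ |x| ^ 5 := by
    have ha : |12 + 6 * x + x ^ 2| ≤ 19 := by
      rw [abs_le] at hx1 ⊢
      constructor <;> nlinarith
    have hb : |x ^ 5 / 12| = |x| ^ 5 / 12 := by simp [abs_div, abs_pow]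
    have hc : |x ^ 6 / 24| = |x| ^ 6 / 24 := by simp [abs_div]
    have hd : |(12 + 6 * x + x ^ 2) * δ| ≤ 19 * (|x| ^ 5 / 100) := by
      rw [abs_mul]
      gcongr
    have he : |x| ^ 6 ≤ |x| ^ 5 * (1 / 2) := by
      rw [pow_succ |x| 5]; gcongr
    have hf := abs_add_le (x ^ 5 / 12 + x ^ 6 / 24) ((12 + 6 * x + x ^ 2) * δ)
    have hg := abs_add_le (x ^ 5 / 12) (x ^ 6 / 24)
    have : 0 < |x| ^ 5 := by positivity
    linarith
  refine h1.trans ?_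
  rw [abs_mul, abs_mul, abs_of_pos (show (0 : ℝ) < 12 by norm_num)]
  calc |x| ^ 5 ≤ |x| ^ 3 * (12 * |x| * (|x| / 2)) := by nlinarith [pow_pos hp 5]
    _ ≤ _ := by gcongr

/-- The remainder must be o(t²), since in a product of three factors the other two contribute a pole
of order 2. -/
theorem tendsto_todd_remainder {n : ℝ} (hn : n ≠ 0) :
    Tendsto (fun t : ℝ => (1 / (1 - Real.exp (-(t * n))) -
      (1 / (t * n) + 1 / 2 + t * n / 12)) / t ^ 2) (𝓝[>] 0) (𝓝 0) := by
  have h0 : Tendsto (fun t : ℝ => |n| ^ 3 * t) (𝓝[>] 0) (𝓝 0) := by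
    have : Tendsto (fun t : ℝ => |n| ^ 3 * t) (𝓝 0) (𝓝 (|n| ^ 3 * 0)) :=
      Continuous.tendsto (by fun_prop) 0
    rw [mul_zero] at this
    exact this.mono_left nhdsWithin_le_nhds
  refine squeeze_zero_norm' ?_ h0
  have h1 : ∀ᶠ t : ℝ in 𝓝[>] 0, |t * n| < 1 / 2 := by
    have : Tendsto (fun t : ℝ => |t * n|) (𝓝 0) (𝓝 (|0 * n|)) :=
      Continuous.tendsto (by fun_prop) 0
    refine (this.mono_left nhdsWithin_le_nhds).eventually (gt_mem_nhds ?_)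
    simp
  filter_upwards [h1, self_mem_nhdsWithin] with t ht ht0
  have ht0 : 0 < t := ht0
  have h2 := abs_one_div_one_sub_exp_sub_le (mul_ne_zero ht0.ne' hn) ht.le
  rw [Real.norm_eq_abs, abs_div, abs_of_pos (by positivity : 0 < t ^ 2), div_le_iff₀ (by positivity)]
  refine h2.trans_eq ?_
  rw [abs_mul, abs_of_pos ht0]
  ring

/-- The constant term of the Laurent expansion of a product of three Todd functions. -/
theorem tendsto_todd_mul {x y z : ℝ} (hx : x ≠ 0) (hy : y ≠ 0) (hz : z ≠ 0) :
    ∃ α β γ : ℝ, Tendsto (fun t : ℝ => 1 / (1 - Real.exp (-(t * x))) *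
        (1 / (1 - Real.exp (-(t * y)))) * (1 / (1 - Real.exp (-(t * z)))) -
        (α / t ^ 3 + β / t ^ 2 + γ / t)) (𝓝[>] 0)
      (𝓝 ((x + y + z) * (1 / x + 1 / y + 1 / z) / 24)) := by
  refine ⟨1 / (x * y * z), (1 / (x * y) + 1 / (x * z) + 1 / (y * z)) / 2,
    (1 / x + 1 / y + 1 / z) / 4 + (x / (y * z) + y / (x * z) + z / (x * y)) / 12, ?_⟩
  set R : ℝ → ℝ → ℝ := fun n t => (1 / (1 - Real.exp (-(t * n))) -
      (1 / (t * n) + 1 / 2 + t * n / 12)) / t ^ 2 with hR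
  set A : ℝ → ℝ → ℝ := fun n t => 1 / n + t / 2 + n * t ^ 2 / 12 with hA
  have hRt : ∀ n : ℝ, n ≠ 0 → Tendsto (R n) (𝓝[>] 0) (𝓝 0) := fun n hn => tendsto_todd_remainder hn
  have hid : Tendsto (fun t : ℝ => t) (𝓝[>] 0) (𝓝 0) := nhdsWithin_le_nhds
  have hAt : ∀ n : ℝ, Tendsto (A n) (𝓝[>] 0) (𝓝 (1 / n)) := by
    intro n
    have : Tendsto (A n) (𝓝 0) (𝓝 (A n 0)) := Continuous.tendsto (by fun_prop) 0
    simp only [hA, zero_div, add_zero, ne_eq, OfNat.ofNat_ne_zero, not_false_eq_true, zero_pow,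
      mul_zero] at this
    exact this.mono_left nhdsWithin_le_nhds
  -- Each factor is `A / t + t ^ 2 * R`. This is the product of the three `A / t` without its polar
  -- part; `hRc` collects the terms containing some `R`.
  have hAc : Tendsto (fun t : ℝ => (x + y + z) * (1 / x + 1 / y + 1 / z) / 24 +
      t * ((x + y + z) / 48 + (y * z / x + x * z / y + x * y / z) / 144) +
      t ^ 2 * ((y * z + x * z + x * y) / 288) + t ^ 3 * (x * y * z / 1728)) (𝓝[>] 0)
      (𝓝 ((x + y + z) * (1 / x + 1 / y + 1 / z) / 24)) := by
    have : Tendsto (fun t : ℝ => (x + y + z) * (1 / x + 1 / y + 1 / z) / 24 +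
      t * ((x + y + z) / 48 + (y * z / x + x * z / y + x * y / z) / 144) +
      t ^ 2 * ((y * z + x * z + x * y) / 288) + t ^ 3 * (x * y * z / 1728)) (𝓝 0) (𝓝 _) :=
      Continuous.tendsto (by fun_prop) 0
    simp only [zero_mul, add_zero, ne_eq, OfNat.ofNat_ne_zero, not_false_eq_true, zero_pow] at this
    exact this.mono_left nhdsWithin_le_nhds
  have hRc : Tendsto (fun t : ℝ => R x t * A y t * A z t + A x t * R y t * A z t +
      A x t * A y t * R z t + t ^ 3 * (R x t * R y t * A z t + R x t * A y t * R z t +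
      A x t * R y t * R z t) + t ^ 6 * (R x t * R y t * R z t)) (𝓝[>] 0) (𝓝 0) := by
    have a := hRt x hx; have b := hRt y hy; have c := hRt z hz
    have a' := hAt x; have b' := hAt y; have c' := hAt z
    have := ((((a.mul b').mul c').add ((a'.mul b).mul c')).add ((a'.mul b').mul c)).add
      ((hid.pow 3).mul ((((a.mul b).mul c').add ((a.mul b').mul c)).add ((a'.mul b).mul c)))
      |>.add ((hid.pow 6).mul ((a.mul b).mul c))
    simpa using this
  have := hAc.add hRc
  rw [add_zero] at this
  refine this.congr' ?_
  filter_upwards [self_mem_nhdsWithin] with t ht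
  have ht : t ≠ 0 := ne_of_gt ht
  have key : ∀ n : ℝ, n ≠ 0 → 1 / (1 - Real.exp (-(t * n))) = A n t / t + t ^ 2 * R n t := by
    intro n hn
    simp only [hR, hA]
    field_simp
    ring
  rw [key x hx, key y hy, key z hz]
  generalize R x t = r₁
  generalize R y t = r₂
  generalize R z t = r₃
  simp only [hA]
  field_simp
  ring

/-- With Z the dilation t ↦ 2t, the operator (2Z - 1)(4Z - 1)(8Z - 1) = 64Z³ - 56Z² + 14Z - 1 kills
1/t, 1/t² and 1/t³, and multiplies the limit by 21. -/
theorem eq_zero_of_tendsto_laurent {α β γ L : ℝ}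
    (h : Tendsto (fun t : ℝ => α / t ^ 3 + β / t ^ 2 + γ / t) (𝓝[>] 0) (𝓝 L)) : L = 0 := by
  have hs : ∀ c : ℝ, 0 < c → Tendsto (fun t : ℝ => c * t) (𝓝[>] 0) (𝓝[>] 0) := by
    intro c hc
    refine tendsto_nhdsWithin_iff.2 ⟨?_, ?_⟩
    · have : Tendsto (fun t : ℝ => c * t) (𝓝 0) (𝓝 (c * 0)) := Continuous.tendsto (by fun_prop) 0
      rw [mul_zero] at this
      exact this.mono_left nhdsWithin_le_nhds
    · filter_upwards [self_mem_nhdsWithin] with t ht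
      exact mul_pos hc ht
  have h1 := ((((h.comp (hs 8 (by norm_num))).const_mul 64).sub
    ((h.comp (hs 4 (by norm_num))).const_mul 56)).add
    ((h.comp (hs 2 (by norm_num))).const_mul 14)).sub h
  have h2 : Tendsto (fun _ : ℝ => (0 : ℝ)) (𝓝[>] (0 : ℝ)) (𝓝 (64 * L - 56 * L + 14 * L - L)) := by
    refine h1.congr' ?_
    filter_upwards [self_mem_nhdsWithin] with t ht
    have ht : t ≠ 0 := ne_of_gt ht
    simp only [Function.comp]
    field_simp
    ring
  have := tendsto_nhds_unique h2 tendsto_const_nhds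
  linarith

/-! ### Wall crossing, generic vectors and sums over flags -/

namespace ConeFan

variable {V : Type*} [NormedAddCommGroup V] [NormedSpace ℝ V]

open Classical in
/-- `i` and `i'` complete the wall `J` to its two maximal simplices, `f` is the primitive functional
that vanishes on `J` and is positive at `i`, and `a` are the coefficients of the wall relation. -/
structure IsWallSides (Δ : ConeFan V) (N : Submodule ℤ V) [DiscreteTopology N] (J : Finset V)
    (i i' : V) (a : V → ℤ) (f : V →ₗ[ℝ] ℝ) : Prop where
  apply_wall : ∀ v ∈ J, f v = 0
  apply_left : f i = 1
  apply_right : f i' = -1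
  left_mem : insert i J ∈ Δ.simplices N (Module.finrank ℝ V)
  right_mem : insert i' J ∈ Δ.simplices N (Module.finrank ℝ V)
  relation : i' = (∑ j ∈ J, a j • j) - i
  eq_or_eq : ∀ k, insert k J ∈ Δ.simplices N (Module.finrank ℝ V) → k = i ∨ k = i'

variable {N : Submodule ℤ V} [DiscreteTopology N] {Δ : ConeFan V}

namespace IsWallSides

variable {J : Finset V} {i i' : V} {a : V → ℤ} {f : V →ₗ[ℝ] ℝ}

theorem left_notMem (h : IsWallSides Δ N J i i' a f) : i ∉ J := fun hi => by
  have := h.apply_wall i hi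
  rw [h.apply_left] at this
  exact one_ne_zero this

theorem right_notMem (h : IsWallSides Δ N J i i' a f) : i' ∉ J := fun hi => by
  have := h.apply_wall i' hi
  rw [h.apply_right] at this
  norm_num at this

theorem ne (h : IsWallSides Δ N J i i' a f) : i ≠ i' := by
  intro he
  have := h.apply_right
  rw [← he, h.apply_left] at this
  norm_num at this

variable [IsZLattice ℝ N] [FiniteDimensional ℝ V]

/-- Any admissible pair is `i, i'` in some order, so its sum is `i + i'`; independence of `J` then
fixes the coefficients. -/
theorem hasCurvature_iff (hu : Δ.IsUnimodular N) (h : IsWallSides Δ N J i i' a f) {c : ℤ} :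
    Δ.HasCurvature N J c ↔ c = 2 - ∑ j ∈ J, a j := by
  classical
  constructor
  · rintro ⟨k, k', a', hne, hk, hk', hrel, rfl⟩
    have hsum : k + k' = i + i' := by
      rcases h.eq_or_eq k hk with rfl | rfl <;> rcases h.eq_or_eq k' hk' with rfl | rfl
      · exact (hne rfl).elim
      · rfl
      · exact add_comm _ _
      · exact (hne rfl).elim
    have hi := linearIndepOn_of_mem_simplices hu h.left_mem
    have hJ : LinearIndepOn ℝ id (J : Set V) := hi.mono (by simp)
    have h0 : ∑ j ∈ J, ((a' j : ℝ) - a j) • id j = 0 := by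
      simp only [sub_smul, Int.cast_smul_eq_zsmul, Finset.sum_sub_distrib, id]
      have h1 := h.relation
      have h2 : ∑ j ∈ J, a' j • j = k + k' := by rw [hrel]; abel
      have h3 : ∑ j ∈ J, a j • j = i + i' := by
        conv_rhs => rw [h1]
        abel
      rw [h2, h3, hsum, sub_self]
    congr 1
    refine Finset.sum_congr rfl fun j hj => ?_
    have := linearIndepOn_finset_iff.1 hJ _ h0 j hj
    exact_mod_cast sub_eq_zero.1 this
  · rintro rfl
    exact ⟨i, i', a, h.ne, h.left_mem, h.right_mem, h.relation, rfl⟩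

theorem curv_eq (hu : Δ.IsUnimodular N) (h : IsWallSides Δ N J i i' a f) :
    Δ.curv N J = 2 - ∑ j ∈ J, a j := by
  have h1 : Δ.HasCurvature N J (2 - ∑ j ∈ J, a j) := (h.hasCurvature_iff hu).2 rfl
  exact (h.hasCurvature_iff hu).1 (Classical.epsilon_spec ⟨_, h1⟩)

open Classical in
theorem coord_left (hu : Δ.IsUnimodular N) (h : IsWallSides Δ N J i i' a f) :
    coord (insert i J) i = f :=
  coord_eq_of_mem_simplices hu h.left_mem (by simp) h.apply_left fun w hw hwi =>
    h.apply_wall w (Finset.mem_of_mem_insert_of_ne hw hwi)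

open Classical in
theorem coord_right (hu : Δ.IsUnimodular N) (h : IsWallSides Δ N J i i' a f) :
    coord (insert i' J) i' = -f :=
  coord_eq_of_mem_simplices hu h.right_mem (by simp) (by simp [h.apply_right]) fun w hw hwi => by
    simp [h.apply_wall w (Finset.mem_of_mem_insert_of_ne hw hwi)]

-- Checked on the basis `insert i' J`: at `i'` the wall relation gives `a j - a j = 0`. Thus the
-- coordinates at `j` in the two cones agree on the hyperplane `f = 0`.
open Classical in
theorem coord_wall (hu : Δ.IsUnimodular N) (h : IsWallSides Δ N J i i' a f) {j : V} (hj : j ∈ J) :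
    coord (insert i' J) j = coord (insert i J) j + (a j : ℝ) • f := by
  have hj1 : j ∈ insert i J := Finset.mem_insert_of_mem hj
  have hs := coord_spec hu h.left_mem hj1
  refine coord_eq_of_mem_simplices hu h.right_mem (Finset.mem_insert_of_mem hj) ?_ ?_
  · simp [hs.1, h.apply_wall j hj]
  · intro w hw hwj
    rcases Finset.mem_insert.1 hw with rfl | hw
    · have h1 : coord (insert i J) j i = 0 :=
        hs.2 i (by simp) (ne_of_mem_of_not_mem hj h.left_notMem).symm
      have h2 : coord (insert i J) j w = a j := by
        rw [h.relation, map_sub, h1, sub_zero, map_sum, Finset.sum_eq_single j]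
        · rw [← Int.cast_smul_eq_zsmul ℝ, map_smul, hs.1, smul_eq_mul, mul_one]
        · intro u hu' huj
          rw [← Int.cast_smul_eq_zsmul ℝ, map_smul, hs.2 u (Finset.mem_insert_of_mem hu') huj,
            smul_zero]
        · exact fun hn => (hn hj).elim
      simp [h2, h.apply_right]
    · simp [hs.2 w (Finset.mem_insert_of_mem hw) hwj, h.apply_wall w hw]

end IsWallSides

/-- A vector is generic if it lies in no proper subspace spanned by rays of the fan. -/
def IsGeneric (Δ : ConeFan V) (N : Submodule ℤ V) [DiscreteTopology N] (x : V) : Prop :=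
  ∀ I ⊆ Δ.rayGenerators N, Submodule.span ℝ (I : Set V) ≠ ⊤ → x ∉ Submodule.span ℝ (I : Set V)

/-- A real vector space is not a finite union of proper subspaces. -/
theorem exists_isGeneric (Δ : ConeFan V) (N : Submodule ℤ V) [DiscreteTopology N]
    (s : Finset (V →ₗ[ℝ] ℝ)) (hs : ∀ f ∈ s, f ≠ 0) :
    ∃ x, Δ.IsGeneric N x ∧ ∀ f ∈ s, f x ≠ 0 := by
  classical
  let t : Finset (Submodule ℝ V) := s.image LinearMap.ker ∪
    {p ∈ (Δ.rayGenerators N).powerset.image fun I : Finset V => Submodule.span ℝ (I : Set V) |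
      p ≠ ⊤}
  have ht : ⊤ ∉ t := by
    simp only [t, Finset.mem_union, Finset.mem_image, Finset.mem_filter, not_or]
    refine ⟨?_, by simp⟩
    rintro ⟨f, hf, hk⟩
    exact hs f hf (LinearMap.ker_eq_top.1 hk)
  obtain ⟨x, hx⟩ := (Set.ne_univ_iff_exists_notMem _).1
    (Subspace.biUnion_ne_univ_of_top_notMem (s := t) ht)
  simp only [Set.mem_iUnion, not_exists] at hx
  refine ⟨x, fun I hI hne => hx _ ?_, fun f hf h0 => hx (LinearMap.ker f) ?_ h0⟩
  · exact Finset.mem_union_right _ (Finset.mem_filter.2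
      ⟨Finset.mem_image.2 ⟨I, Finset.mem_powerset.2 hI, rfl⟩, hne⟩)
  · exact Finset.mem_union_left _ (Finset.mem_image_of_mem _ hf)

variable [IsZLattice ℝ N] [FiniteDimensional ℝ V]

theorem exists_isWallSides (hc : Δ.IsComplete) (hu : Δ.IsUnimodular N)
    (hn : 0 < Module.finrank ℝ V) {J : Finset V} (hJ : J ∈ Δ.walls N) :
    ∃ i i' a f, IsWallSides Δ N J i i' a f := by
  classical
  obtain ⟨i, i', a, f, h1, h2, h3, h4, h5, h6, h7⟩ := exists_wall_sides hc hu hn hJ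
  exact ⟨i, i', a, f, h1, h2, h3, h4, h5, h6, h7⟩

open Classical in
/-- A sum over flags of a maximal simplex and one of its vertices is a sum over walls. -/
theorem sum_sum_eq_sum_walls (hc : Δ.IsComplete) (hu : Δ.IsUnimodular N)
    (hn : 0 < Module.finrank ℝ V) {g : Finset V → V → ℝ} {h : Finset V → ℝ}
    (hgh : ∀ J ∈ Δ.walls N, ∀ i i' a f, IsWallSides Δ N J i i' a f →
      g (insert i J) i + g (insert i' J) i' = h J) :
    ∑ I ∈ Δ.simplices N (Module.finrank ℝ V), ∑ v ∈ I, g I v = ∑ J ∈ Δ.walls N, h J := by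
  rw [Finset.sum_sigma' (Δ.simplices N (Module.finrank ℝ V)) (fun I => I) (fun I v => g I v)]
  have hmaps : ∀ p ∈ (Δ.simplices N (Module.finrank ℝ V)).sigma (fun I => I),
      p.1.erase p.2 ∈ Δ.walls N := by
    rintro ⟨I, v⟩ hp
    obtain ⟨hI, hv⟩ := Finset.mem_sigma.1 hp
    have := mem_simplices_of_subset hu hI (Finset.erase_subset v I)
    rwa [Finset.card_erase_of_mem hv, (mem_simplices.1 hI).2.1] at this
  rw [← Finset.sum_fiberwise_of_maps_to hmaps]
  refine Finset.sum_congr rfl fun J hJ => ?_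
  obtain ⟨i, i', a, f, hs⟩ := exists_isWallSides hc hu hn hJ
  rw [← hgh J hJ i i' a f hs]
  have hfil : {p ∈ (Δ.simplices N (Module.finrank ℝ V)).sigma (fun I => I) | p.1.erase p.2 = J} =
      {⟨insert i J, i⟩, ⟨insert i' J, i'⟩} := by
    ext ⟨I, v⟩
    simp only [Finset.mem_filter, Finset.mem_sigma, Finset.mem_insert, Finset.mem_singleton]
    constructor
    · rintro ⟨⟨hI, hv⟩, rfl⟩
      rw [← Finset.insert_erase hv] at hI
      rcases hs.eq_or_eq v hI with rfl | rfl
      · left; rw [Finset.insert_erase hv]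
      · right; rw [Finset.insert_erase hv]
    · rintro (h | h)
      · cases h
        exact ⟨⟨hs.left_mem, by simp⟩, Finset.erase_insert hs.left_notMem⟩
      · cases h
        exact ⟨⟨hs.right_mem, by simp⟩, Finset.erase_insert hs.right_notMem⟩
  rw [hfil, Finset.sum_pair]
  intro he
  exact hs.ne (congrArg Sigma.snd he)

theorem IsGeneric.coord_ne_zero (hu : Δ.IsUnimodular N) {x : V} (hx : Δ.IsGeneric N x)
    {I : Finset V} (hI : I ∈ Δ.simplices N (Module.finrank ℝ V)) {v : V} (hv : v ∈ I) :
    coord I v x ≠ 0 := by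
  classical
  intro h0
  obtain ⟨h1, h2⟩ := coord_spec hu hI hv
  refine hx (I.erase v) ((Finset.erase_subset _ _).trans (mem_simplices.1 hI).1) ?_ ?_
  · intro htop
    have : coord I v = 0 := LinearMap.ext_on htop fun w hw => by
      obtain ⟨hwv, hw⟩ := Finset.mem_erase.1 hw
      simp [h2 w hw hwv]
    rw [this] at h1
    simp at h1
  · rw [← sum_coord_smul hu hI x, ← Finset.add_sum_erase I _ hv, h0, zero_smul, zero_add]
    exact Submodule.sum_mem _ fun w hw => Submodule.smul_mem _ _ (Submodule.subset_span hw)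

/-- Write the right side as a sum over flags. With s the sum of the `J`-coordinates on the left, the
flags over `J` give (f + s)/f + (-f + s + (∑ a) f)/(-f) = 2 - ∑ a, all at `x`. -/
theorem sum_curv_eq (hc : Δ.IsComplete) (hu : Δ.IsUnimodular N) (hn : 0 < Module.finrank ℝ V)
    {x : V} (hx : Δ.IsGeneric N x) :
    ∑ J ∈ Δ.walls N, (Δ.curv N J : ℝ) = ∑ I ∈ Δ.simplices N (Module.finrank ℝ V),
      (∑ v ∈ I, coord I v x) * ∑ v ∈ I, 1 / coord I v x := by
  classical
  simp only [Finset.mul_sum, mul_one_div]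
  refine (sum_sum_eq_sum_walls hc hu hn ?_).symm
  intro J hJ i i' a f h
  have hf : f x ≠ 0 := by
    rw [← h.coord_left hu]
    exact hx.coord_ne_zero hu h.left_mem (by simp)
  rw [h.curv_eq hu, Finset.sum_insert h.left_notMem, Finset.sum_insert h.right_notMem,
    h.coord_left hu, h.coord_right hu]
  have hsum : ∑ j ∈ J, coord (insert i' J) j x =
      ∑ j ∈ J, coord (insert i J) j x + (∑ j ∈ J, (a j : ℝ)) * f x := by
    rw [Finset.sum_mul, ← Finset.sum_add_distrib]
    exact Finset.sum_congr rfl fun j hj => by simp [h.coord_wall hu hj]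
  rw [hsum, LinearMap.neg_apply]
  push_cast
  field_simp
  ring

/-! ### Signed counts of maximal cones -/

/-- The signed number of maximal cones in which the coordinate signs of `x` match the signs of `μ`
on the generators. -/
noncomputable def signedCount (Δ : ConeFan V) (N : Submodule ℤ V) [DiscreteTopology N]
    (μ : V →ₗ[ℝ] ℝ) (x : V) : ℝ :=
  ∑ I ∈ Δ.simplices N (Module.finrank ℝ V),
    ∏ v ∈ I, (posStep (coord I v x) - posStep (-μ v))

/-- On the way from `x` to `y` the count can only jump where a coordinate vanishes, that is, on the
hyperplane of a wall, and there the jumps of the two adjacent cones cancel. By `hxy`, coordinates of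
one cone vanish at distinct times. -/
theorem signedCount_eq (hV : Module.finrank ℝ V = 3) (hc : Δ.IsComplete) (hu : Δ.IsUnimodular N)
    {x y : V} (hx : Δ.IsGeneric N x) (hy : Δ.IsGeneric N y)
    (hxy : ∀ I ∈ Δ.simplices N (Module.finrank ℝ V), ∀ v ∈ I, ∀ w ∈ I, v ≠ w →
      coord I v x * coord I w y - coord I w x * coord I v y ≠ 0) (μ : V →ₗ[ℝ] ℝ) :
    Δ.signedCount N μ x = Δ.signedCount N μ y := by
  classical
  rw [← sub_eq_zero, signedCount, signedCount, ← Finset.sum_sub_distrib]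
  have hsum : ∀ I ∈ Δ.simplices N (Module.finrank ℝ V),
      ∏ v ∈ I, (posStep (coord I v x) - posStep (-μ v)) -
        ∏ v ∈ I, (posStep (coord I v y) - posStep (-μ v)) =
      ∑ v ∈ I, (posStep (coord I v x) - posStep (coord I v y)) * ∏ u ∈ I.erase v,
        (posStep (coord I u x - coord I v x / coord I v y * coord I u y) - posStep (-μ u)) := by
    intro I hI
    have hcard := (mem_simplices.1 hI).2.1
    rw [hV] at hcard
    obtain ⟨p, q, r, hpq, hpr, hqr, hIe⟩ := Finset.card_eq_three.1 hcard
    have hp : p ∈ I := by simp [hIe]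
    have hq : q ∈ I := by simp [hIe]
    have hr : r ∈ I := by simp [hIe]
    have key := posStep_mul_sub_posStep_mul (hx.coord_ne_zero hu hI hp)
      (hx.coord_ne_zero hu hI hq) (hx.coord_ne_zero hu hI hr) (hy.coord_ne_zero hu hI hp)
      (hy.coord_ne_zero hu hI hq) (hy.coord_ne_zero hu hI hr) (hxy I hI p hp q hq hpq)
      (hxy I hI p hp r hr hpr) (hxy I hI q hq r hr hqr) (posStep (-μ p)) (posStep (-μ q))
      (posStep (-μ r))
    have e1 : I.erase p = {q, r} := by
      rw [hIe, Finset.erase_insert (by simp [hpq, hpr])]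
    have e2 : I.erase q = {p, r} := by
      rw [hIe, Finset.insert_comm, Finset.erase_insert (by simp [hpq.symm, hqr])]
    have e3 : I.erase r = {p, q} := by
      rw [hIe, Finset.pair_comm q r, Finset.insert_comm,
        Finset.erase_insert (by simp [hpr.symm, hqr.symm])]
    have s1 : ∀ F : V → ℝ, ∑ v ∈ I, F v = F p + F q + F r := fun F => by
      rw [hIe, Finset.sum_insert (by simp [hpq, hpr]), Finset.sum_pair hqr, add_assoc]
    have s2 : ∀ F : V → ℝ, ∏ v ∈ I, F v = F p * F q * F r := fun F => by
      rw [hIe, Finset.prod_insert (by simp [hpq, hpr]), Finset.prod_pair hqr, mul_assoc]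
    rw [s1, s2, s2, e1, e2, e3, Finset.prod_pair hqr, Finset.prod_pair hpr, Finset.prod_pair hpq]
    exact key
  rw [Finset.sum_congr rfl hsum]
  rw [sum_sum_eq_sum_walls hc hu (by omega) (h := fun _ => 0) ?_, Finset.sum_const_zero]
  intro J hJ i i' a f h
  have hfx : f x ≠ 0 := by
    rw [← h.coord_left hu]
    exact hx.coord_ne_zero hu h.left_mem (by simp)
  have hfy : f y ≠ 0 := by
    rw [← h.coord_left hu]
    exact hy.coord_ne_zero hu h.left_mem (by simp)
  rw [Finset.erase_insert h.left_notMem, Finset.erase_insert h.right_notMem, h.coord_left hu,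
    h.coord_right hu]
  -- The arguments are coordinates of the crossing point `x - (f x / f y) • y`, where `f` vanishes,
  -- so by `coord_wall` both cones give the same ones.
  have hprod : ∏ u ∈ J, (posStep (coord (insert i' J) u x -
      (-f) x / (-f) y * coord (insert i' J) u y) - posStep (-μ u)) =
      ∏ u ∈ J, (posStep (coord (insert i J) u x - f x / f y * coord (insert i J) u y) -
        posStep (-μ u)) := by
    refine Finset.prod_congr rfl fun u hu' => ?_
    rw [h.coord_wall hu hu']
    congr 2
    simp only [LinearMap.add_apply, LinearMap.smul_apply, LinearMap.neg_apply, smul_eq_mul,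
      neg_div_neg_eq]
    field_simp
    ring
  rw [hprod, LinearMap.neg_apply, LinearMap.neg_apply, posStep_neg hfx, posStep_neg hfy]
  ring

/-- A nonzero factor forces `coord I v y * μ v ≥ 0`; if all factors of some `I` were nonzero,
summing over `v` would give `μ y ≥ 0`. -/
theorem signedCount_eq_zero_of_apply_neg (hu : Δ.IsUnimodular N) {y : V} {μ : V →ₗ[ℝ] ℝ}
    (hμ : μ y < 0) : Δ.signedCount N μ y = 0 := by
  refine Finset.sum_eq_zero fun I hI => ?_
  by_contra hne
  rw [← ne_eq, Finset.prod_ne_zero_iff] at hne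
  rw [apply_eq_sum_coord hu hI] at hμ
  refine hμ.not_ge (Finset.sum_nonneg fun v hv => ?_)
  have h1 := hne v hv
  rcases le_or_gt (coord I v y) 0 with h2 | h2 <;> rcases le_or_gt 0 (μ v) with h3 | h3
  · simp [posStep_of_nonpos h2, posStep_of_nonpos (neg_nonpos.2 h3)] at h1
  · exact mul_nonneg_of_nonpos_of_nonpos h2 h3.le
  · positivity
  · simp [posStep_of_pos h2, posStep_of_pos (neg_pos.2 h3)] at h1

/-- For `μ = 0` each product is the indicator of the open cone, and a generic `x` lies in exactly
one. -/
theorem signedCount_zero (hc : Δ.IsComplete) (hu : Δ.IsUnimodular N) {x : V}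
    (hx : Δ.IsGeneric N x) : Δ.signedCount N 0 x = 1 := by
  classical
  obtain ⟨σ, hσ, hxσ⟩ := hc x
  obtain ⟨I, hI, rfl, -⟩ := exists_simplex_of_mem_cones hu hσ
  have htop : Submodule.span ℝ (I : Set V) = ⊤ := by
    by_contra hne
    exact hx I (mem_simplices.1 hI).1 hne (hull_le_span ℝ (I : Set V) hxσ)
  have hind := linearIndepOn_of_mem_simplices hu hI
  have hcard : I.card = Module.finrank ℝ V := by
    rw [← finrank_top, ← htop, finrank_span_finset_eq_card]
    exact hind
  rw [hcard] at hI
  obtain ⟨c, hc0, hsum⟩ := mem_hull_finset.1 hxσ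
  have hcoord : ∀ v ∈ I, coord I v x = c v := by
    intro v hv
    obtain ⟨h1, h2⟩ := coord_spec hu hI hv
    rw [← hsum, map_sum, Finset.sum_eq_single v]
    · rw [map_smul, h1, smul_eq_mul, mul_one]
    · intro w hw hwv
      rw [map_smul, h2 w hw hwv, smul_zero]
    · exact fun h => (h hv).elim
  rw [signedCount, Finset.sum_eq_single I]
  · refine Finset.prod_eq_one fun v hv => ?_
    have h1 : 0 < coord I v x := lt_of_le_of_ne (by rw [hcoord v hv]; exact hc0 v)
      (hx.coord_ne_zero hu hI hv).symm
    rw [posStep_of_pos h1, LinearMap.zero_apply, neg_zero, posStep_of_nonpos le_rfl, sub_zero]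
  · intro I' hI' hne
    by_contra hp
    rw [← ne_eq, Finset.prod_ne_zero_iff] at hp
    apply hne
    refine Finset.eq_of_subset_of_card_le (subset_of_sum_mem_hull hI' hI
      (c := fun v => coord I' v x) (fun v hv => ?_) ?_) ?_
    · by_contra h
      apply hp v hv
      rw [posStep_of_nonpos (not_lt.1 h), LinearMap.zero_apply, neg_zero,
        posStep_of_nonpos le_rfl, sub_zero]
    · rw [sum_coord_smul hu hI']
      exact hxσ
    · rw [(mem_simplices.1 hI').2.1, (mem_simplices.1 hI).2.1]
  · exact fun h => (h hI).elim

theorem signedCount_eq_zero (hV : Module.finrank ℝ V = 3) (hc : Δ.IsComplete)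
    (hu : Δ.IsUnimodular N) {x : V} (hx : Δ.IsGeneric N x) {μ : V →ₗ[ℝ] ℝ} (hμ : μ ≠ 0) :
    Δ.signedCount N μ x = 0 := by
  classical
  -- Besides being generic, `y` must satisfy `μ y ≠ 0` and make all 2×2 minors with `x` nonzero. A
  -- minor is a nonzero functional of `y`: its value at `w` is `coord I v x`. If `μ y > 0`, then
  -- `-y` serves instead.
  obtain ⟨y, hy, hys⟩ := Δ.exists_isGeneric N
    (insert μ ((Δ.simplices N (Module.finrank ℝ V)).biUnion fun I =>
      I.offDiag.image fun p => coord I p.1 x • coord I p.2 - coord I p.2 x • coord I p.1)) (by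
    intro f hf
    rcases Finset.mem_insert.1 hf with rfl | hf
    · exact hμ
    · obtain ⟨I, hI, hf⟩ := Finset.mem_biUnion.1 hf
      obtain ⟨⟨v, w⟩, hp, rfl⟩ := Finset.mem_image.1 hf
      obtain ⟨hv, hw, hvw⟩ := Finset.mem_offDiag.1 hp
      intro h0
      have := LinearMap.congr_fun h0 w
      simp [(coord_spec hu hI hw).1, (coord_spec hu hI hv).2 w hw hvw.symm,
        hx.coord_ne_zero hu hI hv] at this)
  have hxy : ∀ I ∈ Δ.simplices N (Module.finrank ℝ V), ∀ v ∈ I, ∀ w ∈ I, v ≠ w →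
      coord I v x * coord I w y - coord I w x * coord I v y ≠ 0 := by
    intro I hI v hv w hw hvw
    have := hys (coord I v x • coord I w - coord I w x • coord I v)
      (Finset.mem_insert_of_mem (Finset.mem_biUnion.2 ⟨I, hI, Finset.mem_image.2
        ⟨(v, w), Finset.mem_offDiag.2 ⟨hv, hw, hvw⟩, rfl⟩⟩))
    simpa using this
  have hμy := hys μ (Finset.mem_insert_self _ _)
  rcases hμy.lt_or_gt with h | h
  · rw [signedCount_eq hV hc hu hx hy hxy, signedCount_eq_zero_of_apply_neg hu h]
  · have hy' : Δ.IsGeneric N (-y) := fun I hI hne hm => hy I hI hne (by simpa using hm)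
    rw [signedCount_eq hV hc hu hx hy' fun I hI v hv w hw hvw h0 => hxy I hI v hv w hw hvw (by
      simp only [map_neg] at h0; linarith)]
    exact signedCount_eq_zero_of_apply_neg hu (by simpa using h)

/-! ### Summation over the dual lattice and the constant term -/

theorem exists_linearMap_extend {ι : Type*} [Finite ι] (b : Module.Basis ι ℤ N)
    (m : N →ₗ[ℤ] ℤ) : ∃ μ : V →ₗ[ℝ] ℝ, ∀ x : N, μ x = m x := by
  let μ : V →ₗ[ℝ] ℝ := (b.ofZLatticeBasis ℝ N).constr ℝ fun k => (m (b k) : ℝ)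
  have h : (μ.restrictScalars ℤ) ∘ₗ N.subtype = (Int.castAddHom ℝ).toIntLinearMap ∘ₗ m := by
    refine b.ext fun k => ?_
    have := (b.ofZLatticeBasis ℝ N).constr_basis ℝ (fun k => (m (b k) : ℝ)) k
    rw [b.ofZLatticeBasis_apply ℝ N] at this
    simpa using this
  exact ⟨μ, fun x => LinearMap.congr_fun h x⟩

/-- The vertices of `I` form a lattice basis, so `m` ranges freely over its integer values on them,
and the series is the product of the one-dimensional ones. -/
theorem hasSum_simplex (hu : Δ.IsUnimodular N) {x : V} (hx : Δ.IsGeneric N x)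
    {E : (N →ₗ[ℤ] ℤ) → V →ₗ[ℝ] ℝ} (hE : ∀ m (x : N), E m x = m x) {t : ℝ} (ht : 0 < t)
    {I : Finset V} (hI : I ∈ Δ.simplices N (Module.finrank ℝ V)) :
    HasSum (fun m => (∏ v ∈ I, (posStep (coord I v x) - posStep (-E m v))) *
        Real.exp (-(t * E m x)))
      (∏ v ∈ I, 1 / (1 - Real.exp (-(t * coord I v x)))) := by
  classical
  obtain ⟨b, hb⟩ := exists_basis_range_eq hu hI
  have hI' : I = Finset.univ.image (fun k => (b k : V)) := by
    apply Finset.coe_injective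
    rw [hb]
    simp
  have hbinj : Function.Injective (fun k => (b k : V)) :=
    fun k l h => b.injective (Subtype.ext h)
  have hmem : ∀ k, (b k : V) ∈ I := fun k => by rw [hI']; simp
  have hprod : ∀ F : V → ℝ, ∏ v ∈ I, F v = ∏ k, F (b k) := fun F => by
    conv_lhs => rw [hI']
    rw [Finset.prod_image fun _ _ _ _ h => hbinj h]
  have hsum : ∀ F : V → ℝ, ∑ v ∈ I, F v = ∑ k, F (b k) := fun F => by
    conv_lhs => rw [hI']
    rw [Finset.sum_image fun _ _ _ _ h => hbinj h]
  have key := hasSum_pi_prod fun k => hasSum_int_posStep_sub_mul_exp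
    (mul_ne_zero ht.ne' (hx.coord_ne_zero hu hI (hmem k)))
  rw [hprod, ← (b.constr ℤ).toEquiv.hasSum_iff]
  refine key.congr_fun fun z => ?_
  simp only [Function.comp, LinearEquiv.coe_toEquiv]
  rw [apply_eq_sum_coord hu hI, hsum, hprod, Finset.mul_sum, ← Finset.sum_neg_distrib,
    Real.exp_sum, ← Finset.prod_mul_distrib]
  refine Finset.prod_congr rfl fun k _ => ?_
  have h1 : E (b.constr ℤ z) (b k) = z k := by rw [hE, b.constr_basis]
  rw [h1]
  congr 1
  · congr 1
    · simp only [posStep, mul_pos_iff_of_pos_left ht]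
    · simp only [posStep, neg_pos, Int.cast_lt_zero]
  · rw [mul_assoc]

/-- Adding the series of `hasSum_simplex` over all `I`, the coefficient of `exp (-(t * E m x))` is
`signedCount`, so only the term `m = 0` survives. -/
theorem sum_prod_todd_eq_one (hV : Module.finrank ℝ V = 3) (hc : Δ.IsComplete)
    (hu : Δ.IsUnimodular N) {x : V} (hx : Δ.IsGeneric N x) {t : ℝ} (ht : 0 < t) :
    ∑ I ∈ Δ.simplices N (Module.finrank ℝ V),
      ∏ v ∈ I, 1 / (1 - Real.exp (-(t * coord I v x))) = 1 := by
  classical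
  obtain ⟨σ, hσ, -⟩ := hc 0
  obtain ⟨b, -⟩ := hu σ hσ
  choose E hE using exists_linearMap_extend (V := V) b
  have h1 := hasSum_sum fun I (hI : I ∈ Δ.simplices N (Module.finrank ℝ V)) =>
    hasSum_simplex hu hx hE ht hI
  refine h1.unique ((hasSum_ite_eq (0 : N →ₗ[ℤ] ℤ) (1 : ℝ)).congr_fun fun m => ?_)
  rw [← Finset.sum_mul]
  change Δ.signedCount N (E m) x * _ = _
  have h0 : E m = 0 ↔ m = 0 := by
    constructor
    · intro h
      ext y
      have := hE m y
      rw [h] at this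
      rw [LinearMap.zero_apply] at this ⊢
      exact_mod_cast this.symm
    · rintro rfl
      refine (b.ofZLatticeBasis ℝ N).ext fun k => ?_
      rw [b.ofZLatticeBasis_apply ℝ N, hE]
      simp
  split_ifs with hm
  · rw [h0.2 hm, signedCount_zero hc hu hx]
    simp
  · rw [signedCount_eq_zero hV hc hu hx (fun h => hm (h0.1 h)), zero_mul]

theorem sum_coord_mul_sum_inv_coord (hV : Module.finrank ℝ V = 3) (hc : Δ.IsComplete)
    (hu : Δ.IsUnimodular N) {x : V} (hx : Δ.IsGeneric N x) :
    ∑ I ∈ Δ.simplices N (Module.finrank ℝ V),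
      (∑ v ∈ I, coord I v x) * ∑ v ∈ I, 1 / coord I v x = 24 := by
  classical
  have key : ∀ I : Finset V, ∃ α β γ : ℝ, I ∈ Δ.simplices N (Module.finrank ℝ V) →
      Tendsto (fun t : ℝ => ∏ v ∈ I, 1 / (1 - Real.exp (-(t * coord I v x))) -
        (α / t ^ 3 + β / t ^ 2 + γ / t)) (𝓝[>] 0)
      (𝓝 ((∑ v ∈ I, coord I v x) * (∑ v ∈ I, 1 / coord I v x) / 24)) := by
    intro I
    by_cases hI : I ∈ Δ.simplices N (Module.finrank ℝ V)
    · have hcard := (mem_simplices.1 hI).2.1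
      rw [hV] at hcard
      obtain ⟨p, q, r, hpq, hpr, hqr, hIe⟩ := Finset.card_eq_three.1 hcard
      obtain ⟨α, β, γ, h⟩ := tendsto_todd_mul (hx.coord_ne_zero hu hI (v := p) (by simp [hIe]))
        (hx.coord_ne_zero hu hI (v := q) (by simp [hIe]))
        (hx.coord_ne_zero hu hI (v := r) (by simp [hIe]))
      have s1 : ∀ F : V → ℝ, ∑ v ∈ I, F v = F p + F q + F r := fun F => by
        rw [hIe, Finset.sum_insert (by simp [hpq, hpr]), Finset.sum_pair hqr, add_assoc]
      have s2 : ∀ F : V → ℝ, ∏ v ∈ I, F v = F p * F q * F r := fun F => by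
        rw [hIe, Finset.prod_insert (by simp [hpq, hpr]), Finset.prod_pair hqr, mul_assoc]
      exact ⟨α, β, γ, fun _ => by simpa only [s1, s2] using h⟩
    · exact ⟨0, 0, 0, fun h => (hI h).elim⟩
  choose α β γ h using key
  have h1 := tendsto_finsetSum (Δ.simplices N (Module.finrank ℝ V)) h
  -- The products sum to 1 for every `t > 0`, so 1 minus the regularized sum is purely polar; its
  -- limit, 1 minus the sum of the constant terms, must be 0.
  have h2 := (tendsto_const_nhds (x := (1 : ℝ))).sub h1
  have h3 := eq_zero_of_tendsto_laurent
    (α := ∑ I ∈ Δ.simplices N (Module.finrank ℝ V), α I)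
    (β := ∑ I ∈ Δ.simplices N (Module.finrank ℝ V), β I)
    (γ := ∑ I ∈ Δ.simplices N (Module.finrank ℝ V), γ I) (h2.congr' ?_)
  · rw [← Finset.sum_div] at h3
    linarith
  · filter_upwards [self_mem_nhdsWithin] with t ht
    rw [Finset.sum_sub_distrib, sum_prod_todd_eq_one hV hc hu hx ht]
    simp only [Finset.sum_add_distrib, Finset.sum_div]
    ring

end ConeFan

theorem mainTheorem3 {V : Type*} [NormedAddCommGroup V] [NormedSpace ℝ V]
    (hV : Module.finrank ℝ V = 3)
    (N : Submodule ℤ V) [DiscreteTopology N] [IsZLattice ℝ N]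
    (Δ : ConeFan V) (hcomplete : Δ.IsComplete) (hunimodular : Δ.IsUnimodular N) :
    (∀ J ∈ Δ.walls N, ∃! c : ℤ, Δ.HasCurvature N J c) ∧
      ∑ J ∈ Δ.walls N, Δ.curv N J = 24 := by
  have hn : 0 < Module.finrank ℝ V := by omega
  have : FiniteDimensional ℝ V := Module.finite_of_finrank_pos hn
  refine ⟨fun J hJ => ?_, ?_⟩
  · obtain ⟨i, i', a, f, h⟩ := ConeFan.exists_isWallSides hcomplete hunimodular hn hJ
    exact ⟨_, (h.hasCurvature_iff hunimodular).2 rfl,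
      fun c hc => (h.hasCurvature_iff hunimodular).1 hc⟩
  · obtain ⟨x, hx, -⟩ := Δ.exists_isGeneric N ∅ (by simp)
    have h1 := ConeFan.sum_curv_eq hcomplete hunimodular hn hx
    rw [ConeFan.sum_coord_mul_sum_inv_coord hV hcomplete hunimodular hx] at h1
    exact_mod_cast h1
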